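/- Let $f:\mathbb R\to\mathbb R$ be a measurable function with $f(x+1)=f(x)$ for all $x$, such that for some constants $h$ and $\alpha>0$ $$|f(x)-f(y)|\le h|x-y|^{\alpha}\quad (x,y\in[0,1)),\qquad \int_0^1 f(x)\,dx=0,\qquad \int_0^1 f(x)^2\,dx=1 .$$ Let $(m_k)_{k\ge1}$ be an increasing sequence of integers such that $b_k:=m_{k+1}/m_k\in\{2,3,\dots\}$ for all $k$ and $b_k\to\infty$. Let $(a_{k,n})_{1\le k\le n}$ be a triangular array of real numbers such that, as $n\to\infty$, $$A_n:=\Big(\sum_{k=1}^n a_{k,n}^2\Big)^{1/2}\to\infty,\qquad \sum_{k=1}^n|a_{k,n}|^3\to0,\qquad A_n\sum_{k=1}^n\frac{|a_{k,n}|}{b_k^{\alpha}}\to0 .$$ Put $S_n(x)=\sum_{k=1}^n a_{k,n}f(m_kx)$, regarded as a random variable on $[0,1]$ with Lebesgue measure $|\cdot|$, and $\varphi_n(i\lambda)=\int_0^1 e^{i\lambda S_n(x)}\,dx$. Then: (1) $(S_n)$ converges mod-Gaussian in the weak sense, with normalising sequence $(A_n)$; that is, $\varphi_n(i\lambda/A_n)\to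 e^{-\lambda^2/2}$ for every $\lambda\in\mathbb R$, and for every $K\ge0$ the sequence of functions $\lambda\mapsto\varphi_n(i\lambda/A_n)\mathbf 1_{\{|\lambda|\le A_nK\}}$ is uniformly integrable on $\mathbb R$ with respect to Lebesgue measure (bounded in $L^1(\mathbb R)$, with uniformly absolutely continuous integrals, and tight: for every $\varepsilon>0$ there is a set of finite measure outside which all the integrals of the absolute values are at most $\varepsilon$). (2) For every bounded Jordan measurable set $B\subset\mathbb R$ (bounded, with a boundary of Lebesgue measure zero), $$A_n\,\big|\{x\in[0,1]: S_n(x)\in B\}\big|\longrightarrow\frac{|B|}{\sqrt{2\pi}}\qquad(n\to\infty).$$ -/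

import Mathlib

open MeasureTheory Filter Topology Set

noncomputable section

/-- The characteristic function `t ↦ 𝔼[exp (i t X)]` of a real random variable `X`. -/
def expChar {Ω : Type*} [MeasurableSpace Ω] (P : Measure Ω) (X : Ω → ℝ) (t : ℝ) : ℂ :=
  ∫ ω, Complex.exp (((t * X ω : ℝ) : ℂ) * Complex.I) ∂P

/-- A sequence `F n` is uniformly integrable on the real line with Lebesgue measure: it is bounded
in `L¹`, has uniformly absolutely continuous integrals and, the measure being infinite, loses no
mass at infinity. This is the notion for which almost everywhere convergence together with uniform
integrability is convergence in `L¹`. -/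
def UniformlyIntegrableOnLine (F : ℕ → ℝ → ℂ) : Prop :=
  UniformIntegrable F 1 (volume : Measure ℝ) ∧ UnifTight F 1 (volume : Measure ℝ)

/-- Mod-Gaussian convergence (in the weak sense) of a sequence of real random variables `X n`,
with normalising sequence `A n → ∞`. -/
structure ConvergesModGaussianWeak {Ω : Type*} [MeasurableSpace Ω] (P : Measure Ω)
    (X : ℕ → Ω → ℝ) (A : ℕ → ℝ) : Prop where
  aemeasurable : ∀ n, AEMeasurable (X n) P
  tendsto_atTop : Tendsto A atTop atTop
  tendsto_char : ∀ t : ℝ,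
    Tendsto (fun n => expChar P (X n) (t / A n)) atTop (𝓝 (Complex.exp (-((t : ℂ) ^ 2 / 2))))
  uniformlyIntegrable : ∀ K : ℝ, 0 ≤ K →
    UniformlyIntegrableOnLine fun n =>
      {t : ℝ | |t| ≤ A n * K}.indicator fun t => expChar P (X n) (t / A n)

/-- Bounded Jordan measurable subsets of the line: the boundary is a Lebesgue null set. -/
def IsBoundedJordanMeasurable (B : Set ℝ) : Prop :=
  Bornology.IsBounded B ∧ volume (frontier B) = 0

/-- `A_n = (∑_{k=1}^n a_{k,n}²)^{1/2}`; the entry `a_{k,n}` is `a k n`. -/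
def rowNorm (a : ℕ → ℕ → ℝ) (n : ℕ) : ℝ :=
  √(∑ k ∈ Finset.Icc 1 n, a k n ^ 2)

/-- `S_n(x) = ∑_{k=1}^n a_{k,n} f(m_k x)`. -/
def gapSum (f : ℝ → ℝ) (m : ℕ → ℤ) (a : ℕ → ℕ → ℝ) (n : ℕ) (x : ℝ) : ℝ :=
  ∑ k ∈ Finset.Icc 1 n, a k n * f ((m k : ℝ) * x)

end

/-! Since `m (k + 1) = b k * m k`, replacing `f` in the `k`-th summand by the centred step function
`stepApprox f (b k)`, constant on intervals of length `1 / b k`, makes the summands exactly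
independent: the earlier factors are constant on intervals of length `1 / m n`, and on each of these
the `n`-th factor runs through a full period (`integral_prod_step_periodic`). By the Hölder
condition the replacement moves the characteristic function at `s` by at most a constant times `|s|
∑ |a k n| / b k ^ α`, which is `o(1 / A_n)` on compact sets of `s`.

For the independent sum, a second order Taylor expansion of each factor gives the Gaussian `exp
(-A_n² s² v_n / 2)` with `v_n → 1`, up to an error equal to the same Gaussian times a quantity
governed by `∑ |a k n|³` (`norm_prod_sub_exp_neg_sum_le`). As the Gaussian factor survives in the
error, integrating over `|s| ≤ K` gains `1 / A_n`; hence `A_n ∫_{-K}^{K} |φ_n(is) - exp (-A_n² s² /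
2)| ds → 0` for every `K` (`tendsto_mul_integral_norm_sub_gaussian`).

Both conclusions rest on this limit. After `t = A_n s` it is `L¹` convergence of the truncated
characteristic functions, whence uniform integrability. Tested against `sinc²`, whose Fourier
transform has compact support, it shows that `A_n` times the law of `S_n`, weighted by `sinc²`,
converges weakly to the equally weighted measure `dx / √(2π)`; on a bounded set the weight can be
divided out. -/

namespace ModGaussian

/-! ### Weak convergence of finite measures, and removal of a weight -/

/-- Lévy's continuity theorem for finite measures with a nonzero limit. -/
theorem finiteMeasure_tendsto_of_tendsto_charFun {μ : ℕ → FiniteMeasure ℝ} {ν : FiniteMeasure ℝ}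
    (hν : ν ≠ 0)
    (h : ∀ t : ℝ, Tendsto (fun n => charFun (μ n : Measure ℝ) t) atTop
      (𝓝 (charFun (ν : Measure ℝ) t))) :
    Tendsto μ atTop (𝓝 ν) := by
  -- At `t = 0` the characteristic function is the total mass, so the masses converge and the claim
  -- reduces to the normalised probability measures.
  have hmass : Tendsto (fun n => (μ n).mass) atTop (𝓝 ν.mass) := by
    have h0 := (Complex.continuous_re.tendsto _).comp (h 0)
    simp only [charFun_zero, Function.comp_def, Complex.ofReal_re] at h0
    rw [← NNReal.tendsto_coe]
    exact h0
  rw [← FiniteMeasure.tendsto_normalize_iff_tendsto hν]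
  refine ⟨?_, hmass⟩
  have hν' : ν.mass ≠ 0 := (FiniteMeasure.mass_nonzero_iff ν).2 hν
  have key : ∀ (ρ : FiniteMeasure ℝ), ρ ≠ 0 → ∀ t : ℝ,
      charFun (ρ.normalize : Measure ℝ) t = ((ρ.mass⁻¹ : NNReal) : ℂ) * charFun (ρ : Measure ℝ) t := by
    intro ρ hρ t
    rw [FiniteMeasure.toMeasure_normalize_eq_of_nonzero ρ hρ, charFun_apply, charFun_apply,
      integral_smul_nnreal_measure]
    rfl
  rw [ProbabilityMeasure.tendsto_iff_tendsto_charFun]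
  intro t
  rw [key ν hν t]
  have hev : ∀ᶠ n in atTop, μ n ≠ 0 := by
    filter_upwards [hmass.eventually_ne hν'] with n hn
    exact (FiniteMeasure.mass_nonzero_iff _).1 hn
  have : Tendsto (fun n => (((μ n).mass⁻¹ : NNReal) : ℂ) * charFun (μ n : Measure ℝ) t) atTop
      (𝓝 (((ν.mass⁻¹ : NNReal) : ℂ) * charFun (ν : Measure ℝ) t)) := by
    refine Tendsto.mul ?_ (h t)
    have h1 := (NNReal.tendsto_coe.2 (hmass.inv₀ hν'))
    exact (Complex.continuous_ofReal.tendsto _).comp h1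
  refine this.congr' ?_
  filter_upwards [hev] with n hn
  exact (key _ hn t).symm

theorem finiteMeasure_tendsto_real_of_null_frontier {μ : ℕ → FiniteMeasure ℝ}
    {ν : FiniteMeasure ℝ} (hν : ν ≠ 0) (h : Tendsto μ atTop (𝓝 ν)) {E : Set ℝ}
    (hE : (ν : Measure ℝ) (frontier E) = 0) :
    Tendsto (fun n => (μ n : Measure ℝ).real E) atTop (𝓝 ((ν : Measure ℝ).real E)) := by
  obtain ⟨h1, h2⟩ := (FiniteMeasure.tendsto_normalize_iff_tendsto hν).2 h
  have hE' : ν.normalize (frontier E) = 0 := by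
    rw [FiniteMeasure.normalize_eq_of_nonzero ν hν, (FiniteMeasure.null_iff_toMeasure_null _ _).2 hE,
      mul_zero]
  have h3 := h2.mul (ProbabilityMeasure.tendsto_measure_of_null_frontier_of_tendsto h1 hE')
  simp_rw [← FiniteMeasure.self_eq_mass_mul_normalize] at h3
  exact NNReal.tendsto_coe.2 h3

/-- A local limit theorem from convergence of the characteristic functions of weighted measures. -/
theorem tendsto_mul_real_of_tendsto_weighted_charFun
    {P : ℕ → Measure ℝ} [∀ n, IsProbabilityMeasure (P n)] {c : ℕ → ℝ} (hc : ∀ n, 0 ≤ c n)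
    {w : ℝ → ℝ} (hw_cont : Continuous w) (hw0 : ∀ x, 0 ≤ w x) (hw1 : ∀ x, w x ≤ 1)
    (hw_int : Integrable w) {κ : ℝ} (hκ : 0 < κ)
    (hlim : ∀ u : ℝ, Tendsto
      (fun n => (c n : ℂ) * ∫ x, (w x : ℂ) * Complex.exp (u * x * Complex.I) ∂(P n)) atTop
      (𝓝 ((κ : ℂ) * ∫ x, (w x : ℂ) * Complex.exp (u * x * Complex.I))))
    {B : Set ℝ} (hB : MeasurableSet B) (hBf : volume (frontier B) = 0)
    {d : ℝ} (hd : 0 < d) (hwB : ∀ x ∈ B, d ≤ w x) (hw_ne : ∃ x, w x ≠ 0) :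
    Tendsto (fun n => c n * (P n).real B) atTop (𝓝 (κ * volume.real B)) := by
  have hwm : Measurable w := hw_cont.measurable
  set W : ℝ → NNReal := fun x => (w x).toNNReal
  have hWm : Measurable W := hwm.real_toNNReal
  have hWc : ∀ x, ((W x : NNReal) : ℝ) = w x := fun x => Real.coe_toNNReal _ (hw0 x)
  have hfin : ∀ (Q : Measure ℝ), Integrable w Q → ∀ r : NNReal,
      IsFiniteMeasure (Q.withDensity fun x => ((r * W x : NNReal) : ENNReal)) := by
    intro Q hQ r
    have h1 : Integrable (fun x => (r : ℝ) * w x) Q := hQ.const_mul _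
    have := isFiniteMeasure_withDensity_ofReal h1.2
    convert this using 3 with x
    rw [ENNReal.ofReal, Real.toNNReal_mul (NNReal.coe_nonneg r), Real.toNNReal_coe]
  have hPint : ∀ n, Integrable w (P n) := fun n =>
    Integrable.of_bound hwm.aestronglyMeasurable 1
      (ae_of_all _ fun x => by rw [Real.norm_eq_abs, abs_of_nonneg (hw0 x)]; exact hw1 x)
  set C : ℕ → NNReal := fun n => (c n).toNNReal
  have hCc : ∀ n, ((C n : NNReal) : ℝ) = c n := fun n => Real.coe_toNNReal _ (hc n)
  set k : NNReal := κ.toNNReal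
  have hkc : (k : ℝ) = κ := Real.coe_toNNReal _ hκ.le
  have hmeas : ∀ r : NNReal, Measurable fun x => r * W x := fun r => hWm.const_mul r
  -- integrals against the weighted measures
  have hint : ∀ (Q : Measure ℝ) (r : NNReal) (E : Type) [NormedAddCommGroup E] [NormedSpace ℝ E]
      (g : ℝ → E), ∫ x, g x ∂(Q.withDensity fun x => ((r * W x : NNReal) : ENNReal)) =
        (r : ℝ) • ∫ x, w x • g x ∂Q := by
    intro Q r E _ _ g
    rw [integral_withDensity_eq_integral_smul (hmeas r), ← integral_smul]
    congr 1 with x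
    rw [NNReal.smul_def, NNReal.coe_mul, hWc, mul_smul]
  -- `c n • P n` has total mass `c n`, which may tend to infinity; the integrable weight `w` is what
  -- allows a finite weak limit, with density `κ w`.
  let μ : ℕ → FiniteMeasure ℝ := fun n =>
    ⟨(P n).withDensity fun x => ((C n * W x : NNReal) : ENNReal), hfin _ (hPint n) _⟩
  let ν : FiniteMeasure ℝ :=
    ⟨volume.withDensity fun x => ((k * W x : NNReal) : ENNReal), hfin _ hw_int _⟩
  have hwpos : 0 < ∫ x, w x := by
    obtain ⟨x, hx⟩ := hw_ne
    exact integral_pos_of_integrable_nonneg_nonzero hw_cont hw_int hw0 hx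
  have hν : ν ≠ 0 := by
    intro h0
    have h1 : (ν : Measure ℝ) univ = 0 := by rw [h0]; simp
    have h2 := hint volume k ℝ (fun _ => 1)
    have h3 : (volume.withDensity fun x => ((k * W x : NNReal) : ENNReal)) = 0 :=
      Measure.measure_univ_eq_zero.1 h1
    rw [h3] at h2
    simp only [integral_zero_measure, smul_eq_mul, mul_one, hkc] at h2
    exact (mul_pos hκ hwpos).ne h2
  have hμν : Tendsto μ atTop (𝓝 ν) := by
    refine finiteMeasure_tendsto_of_tendsto_charFun hν fun t => ?_
    simp only [charFun_apply_real]
    have e1 : ∀ n, ∫ x, Complex.exp (t * x * Complex.I) ∂(μ n : Measure ℝ) =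
        (c n : ℂ) * ∫ x, (w x : ℂ) * Complex.exp (t * x * Complex.I) ∂(P n) := fun n => by
      refine (hint (P n) (C n) ℂ _).trans ?_
      simp only [Complex.real_smul, hCc]
    have e2 : ∫ x, Complex.exp (t * x * Complex.I) ∂(ν : Measure ℝ) =
        (κ : ℂ) * ∫ x, (w x : ℂ) * Complex.exp (t * x * Complex.I) := by
      refine (hint volume k ℂ _).trans ?_
      simp only [Complex.real_smul, hkc]
    simp_rw [e1, e2]
    exact hlim t
  -- remove the weight where it is at least `d`
  set v : ℝ → ℝ := fun x => (max (w x) d)⁻¹ with hv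
  have hmax : ∀ x, 0 < max (w x) d := fun x => lt_max_of_lt_right hd
  have hv0 : ∀ x, 0 ≤ v x := fun x => inv_nonneg.2 (hmax x).le
  have hvd : ∀ x, v x ≤ d⁻¹ := fun x => inv_anti₀ hd (le_max_right _ _)
  have hv_cont : Continuous v := (hw_cont.max continuous_const).inv₀ fun x => (hmax x).ne'
  set V : ℝ → NNReal := fun x => (v x).toNNReal
  have hVm : Measurable V := hv_cont.measurable.real_toNNReal
  have hVc : ∀ x, ((V x : NNReal) : ℝ) = v x := fun x => Real.coe_toNNReal _ (hv0 x)
  have hVfin : ∀ m : FiniteMeasure ℝ,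
      IsFiniteMeasure ((m : Measure ℝ).withDensity fun x => (V x : ENNReal)) := by
    intro m
    have h1 : Integrable v (m : Measure ℝ) := Integrable.of_bound
      hv_cont.aestronglyMeasurable d⁻¹ (ae_of_all _ fun x => by
        rw [Real.norm_eq_abs, abs_of_nonneg (hv0 x)]; exact hvd x)
    exact isFiniteMeasure_withDensity_ofReal h1.2
  let T : FiniteMeasure ℝ → FiniteMeasure ℝ := fun m =>
    ⟨(m : Measure ℝ).withDensity fun x => (V x : ENNReal), hVfin m⟩
  have hT : ∀ (m : FiniteMeasure ℝ) (g : ℝ → ℝ),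
      ∫ x, g x ∂(T m : Measure ℝ) = ∫ x, v x * g x ∂(m : Measure ℝ) := by
    intro m g
    refine (integral_withDensity_eq_integral_smul hVm g).trans ?_
    simp only [NNReal.smul_def, hVc, smul_eq_mul]
  have hTlim : Tendsto (fun n => T (μ n)) atTop (𝓝 (T ν)) := by
    rw [FiniteMeasure.tendsto_iff_forall_integral_tendsto]
    intro g
    simp_rw [hT]
    let vg : BoundedContinuousFunction ℝ ℝ :=
      BoundedContinuousFunction.ofNormedAddCommGroup (fun x => v x * g x)
        (hv_cont.mul g.continuous) (d⁻¹ * ‖g‖) (fun x => by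
          rw [norm_mul, Real.norm_eq_abs, abs_of_nonneg (hv0 x)]
          exact mul_le_mul (hvd x) (g.norm_coe_le_norm x) (norm_nonneg _) (inv_pos.2 hd).le)
    exact FiniteMeasure.tendsto_iff_forall_integral_tendsto.1 hμν vg
  -- On `B` the maximum in `v` is `w` itself, so the densities `w` and `v` cancel there.
  have hTB : ∀ (Q : Measure ℝ) (r : NNReal) (m : FiniteMeasure ℝ),
      (m : Measure ℝ) = Q.withDensity (fun x => ((r * W x : NNReal) : ENNReal)) →
      (T m : Measure ℝ).real B = r * Q.real B := by
    intro Q r m hm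
    have h1 : (T m : Measure ℝ).real B = ∫ x, B.indicator 1 x ∂(T m : Measure ℝ) :=
      (integral_indicator_one hB).symm
    rw [h1, hT, hm, hint, smul_eq_mul, ← integral_indicator_one hB]
    congr 2 with x
    by_cases hx : x ∈ B
    · have hx' := hwB x hx
      have : max (w x) d = w x := max_eq_left hx'
      simp only [hx, indicator_of_mem, Pi.one_apply, mul_one, smul_eq_mul, hv, this]
      exact mul_inv_cancel₀ (hd.trans_le hx').ne'
    · simp [hx]
  have hTν : T ν ≠ 0 := by
    intro h0
    have h1 : ∫ x, w x ∂(T ν : Measure ℝ) = 0 := by rw [h0]; simp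
    rw [hT] at h1
    have h2 : ∫ x, v x * w x ∂(ν : Measure ℝ) = k * ∫ x, w x * (v x * w x) := hint volume k ℝ _
    rw [h2] at h1
    obtain ⟨x, hx⟩ := hw_ne
    have h3 : 0 < ∫ x, w x * (v x * w x) := by
      refine integral_pos_of_integrable_nonneg_nonzero (hw_cont.mul (hv_cont.mul hw_cont)) ?_
        (fun x => mul_nonneg (hw0 x) (mul_nonneg (hv0 x) (hw0 x))) (x := x) ?_
      · refine (hw_int.mul_const (d⁻¹ * 1)).mono'
          (hw_cont.mul (hv_cont.mul hw_cont)).aestronglyMeasurable (ae_of_all _ fun x => ?_)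
        rw [Real.norm_eq_abs,
          abs_of_nonneg (mul_nonneg (hw0 x) (mul_nonneg (hv0 x) (hw0 x)))]
        exact mul_le_mul_of_nonneg_left
          (mul_le_mul (hvd x) (hw1 x) (hw0 x) (inv_pos.2 hd).le) (hw0 x)
      · exact mul_ne_zero hx (mul_ne_zero (inv_pos.2 (hmax x)).ne' hx)
    rw [hkc] at h1
    exact (mul_pos hκ h3).ne' h1
  have hac : (T ν : Measure ℝ) ≪ volume :=
    (withDensity_absolutelyContinuous _ _).trans (withDensity_absolutelyContinuous _ _)
  have hfinal := finiteMeasure_tendsto_real_of_null_frontier hTν hTlim (hac hBf)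
  rw [hTB volume k ν rfl, hkc] at hfinal
  simp_rw [fun n => hTB (P n) (C n) (μ n) rfl, hCc] at hfinal
  exact hfinal

/-! ### Test functions `sinc²` with compactly supported Fourier transform -/

theorem integral_exp_eq_two_mul_sinc (r : ℝ) :
    ∫ s in (-1 : ℝ)..1, Complex.exp ((s * r : ℝ) * Complex.I) = 2 * (Real.sinc r : ℂ) := by
  rcases eq_or_ne r 0 with rfl | hr
  · simp; norm_num
  · rw [intervalIntegral.integral_comp_mul_right
      (fun t : ℝ => Complex.exp ((t : ℂ) * Complex.I)) hr]
    rw [neg_one_mul, one_mul, integral_exp_mul_I_eq_sinc, Complex.real_smul]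
    have : (r : ℂ) ≠ 0 := Complex.ofReal_ne_zero.2 hr
    push_cast
    field_simp

/-- `sinc (ε x)` is the average of `exp (i s ε x)` over `s ∈ [-1, 1]`, and Fubini moves the average
outside. Used twice, this writes an integral against `sinc²` through values of `charFun P` on a
compact interval. -/
theorem integral_sinc_mul (P : Measure ℝ) [IsFiniteMeasure P] {g : ℝ → ℂ} (hg : Continuous g)
    {C : ℝ} (hgC : ∀ x, ‖g x‖ ≤ C) (ε : ℝ) :
    ∫ x, (Real.sinc (ε * x) : ℂ) * g x ∂P =
      2⁻¹ * ∫ s in (-1 : ℝ)..1, ∫ x, Complex.exp ((s * (ε * x) : ℝ) * Complex.I) * g x ∂P := by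
  have : IsFiniteMeasure (volume.restrict (uIoc (-1 : ℝ) 1)) :=
    ⟨by rw [Measure.restrict_apply_univ, uIoc]; exact measure_Ioc_lt_top⟩
  rw [intervalIntegral_integral_swap, ← integral_const_mul]
  · congr 1 with x
    rw [intervalIntegral.integral_mul_const, integral_exp_eq_two_mul_sinc]
    ring
  · refine Integrable.of_bound (Continuous.aestronglyMeasurable ?_) C (ae_of_all _ fun p => ?_)
    · unfold Function.uncurry; fun_prop
    · simp only [Function.uncurry, norm_mul, Complex.norm_exp_ofReal_mul_I, one_mul]
      exact hgC _

theorem continuous_exp_ofReal_mul_I (c : ℝ) :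
    Continuous fun x : ℝ => Complex.exp ((c * x : ℝ) * Complex.I) := by fun_prop

theorem integral_sinc_mul_exp (P : Measure ℝ) [IsFiniteMeasure P] (ε c : ℝ) :
    ∫ x, (Real.sinc (ε * x) : ℂ) * Complex.exp ((c * x : ℝ) * Complex.I) ∂P =
      2⁻¹ * ∫ s in (-1 : ℝ)..1, charFun P (ε * s + c) := by
  rw [integral_sinc_mul P (continuous_exp_ofReal_mul_I c)
    (fun x => (Complex.norm_exp_ofReal_mul_I _).le) ε]
  simp_rw [charFun_apply_real, ← Complex.exp_add]
  congr 2 with s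
  congr 1 with x
  push_cast
  ring_nf

theorem integral_sinc_sq_mul_exp (P : Measure ℝ) [IsFiniteMeasure P] (ε c : ℝ) :
    ∫ x, (Real.sinc (ε * x) ^ 2 : ℂ) * Complex.exp ((c * x : ℝ) * Complex.I) ∂P =
      2⁻¹ * ∫ s in (-1 : ℝ)..1,
        ∫ x, (Real.sinc (ε * x) : ℂ) * Complex.exp (((ε * s + c) * x : ℝ) * Complex.I) ∂P := by
  have hs : Continuous fun x => (Real.sinc (ε * x) : ℂ) :=
    Complex.continuous_ofReal.comp (Real.continuous_sinc.comp (by fun_prop))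
  have := integral_sinc_mul P (g := fun x => (Real.sinc (ε * x) : ℂ) *
    Complex.exp ((c * x : ℝ) * Complex.I)) (hs.mul (continuous_exp_ofReal_mul_I c)) (C := 1)
    (fun x => by
      rw [norm_mul, Complex.norm_exp_ofReal_mul_I, mul_one, Complex.norm_real, Real.norm_eq_abs]
      exact Real.abs_sinc_le_one _) ε
  calc _ = ∫ x, (Real.sinc (ε * x) : ℂ) *
        (Real.sinc (ε * x) * Complex.exp ((c * x : ℝ) * Complex.I)) ∂P := by
        congr 1 with x; ring
    _ = _ := by
        rw [this]
        congr 2 with s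
        congr 1 with x
        rw [mul_left_comm, ← Complex.exp_add]
        push_cast
        ring_nf

theorem norm_integral_comp_affine_le {D : ℝ → ℂ} (hD : Continuous D) {ε : ℝ} (hε : 0 < ε)
    {c K : ℝ} (hK : |c| + ε ≤ K) :
    ‖∫ s in (-1 : ℝ)..1, D (ε * s + c)‖ ≤ ε⁻¹ * ∫ t in -K..K, ‖D t‖ := by
  have h1 := abs_le.1 (le_refl |c|)
  refine (intervalIntegral.norm_integral_le_integral_norm (by norm_num)).trans ?_
  rw [intervalIntegral.integral_comp_mul_add (fun t => ‖D t‖) hε.ne', smul_eq_mul]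
  refine mul_le_mul_of_nonneg_left ?_ (inv_pos.2 hε).le
  refine intervalIntegral.integral_mono_interval (by linarith) (by linarith) (by linarith)
    (ae_of_all _ fun t => norm_nonneg _) (hD.norm.intervalIntegrable _ _)

/-- The effect of a change of measure on integrals against a function with compactly supported
Fourier transform is controlled by the characteristic functions on a compact interval. -/
theorem norm_integral_sinc_sq_sub_le (P Q : Measure ℝ) [IsFiniteMeasure P] [IsFiniteMeasure Q]
    {ε : ℝ} (hε : 0 < ε) {u K : ℝ} (hK : |u| + 2 * ε ≤ K) :
    ‖(∫ x, (Real.sinc (ε * x) ^ 2 : ℂ) * Complex.exp ((u * x : ℝ) * Complex.I) ∂P) -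
      ∫ x, (Real.sinc (ε * x) ^ 2 : ℂ) * Complex.exp ((u * x : ℝ) * Complex.I) ∂Q‖ ≤
      ε⁻¹ * ∫ t in -K..K, ‖charFun P t - charFun Q t‖ := by
  have hD : Continuous fun t => charFun P t - charFun Q t :=
    continuous_charFun.sub continuous_charFun
  have hci : ∀ (R : Measure ℝ) [IsFiniteMeasure R] (c : ℝ), IntervalIntegrable
      (fun s => charFun R (ε * s + c)) volume (-1) 1 := fun R _ c =>
    (continuous_charFun.comp (by fun_prop : Continuous fun s : ℝ => ε * s + c)).intervalIntegrable
      _ _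
  let J : Measure ℝ → ℝ → ℂ := fun ν c =>
    ∫ x, (Real.sinc (ε * x) : ℂ) * Complex.exp ((c * x : ℝ) * Complex.I) ∂ν
  have hs : Continuous fun x => (Real.sinc (ε * x) : ℂ) :=
    Complex.continuous_ofReal.comp (Real.continuous_sinc.comp (by fun_prop))
  have hJc : ∀ (R : Measure ℝ) [IsFiniteMeasure R], Continuous (J R) := by
    intro R _
    refine continuous_of_dominated (bound := fun _ => 1)
      (fun c => (hs.mul (continuous_exp_ofReal_mul_I c)).aestronglyMeasurable)
      (fun c => ae_of_all _ fun x => ?_) (integrable_const _) (ae_of_all _ fun x => by fun_prop)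
    rw [norm_mul, Complex.norm_exp_ofReal_mul_I, mul_one, Complex.norm_real, Real.norm_eq_abs]
    exact Real.abs_sinc_le_one _
  -- Each of the two averages shifts the frequency by at most `ε`: the outer one keeps it within
  -- `|u| + ε`, the inner one within `|u| + 2 * ε ≤ K`.
  have hJd : ∀ c, |c| ≤ |u| + ε → ‖J P c - J Q c‖ ≤
      2⁻¹ * (ε⁻¹ * ∫ t in -K..K, ‖charFun P t - charFun Q t‖) := by
    intro c hc
    simp only [J]
    rw [integral_sinc_mul_exp, integral_sinc_mul_exp, ← mul_sub,
      ← intervalIntegral.integral_sub (hci P c) (hci Q c), norm_mul]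
    refine mul_le_mul (by simp) (norm_integral_comp_affine_le hD hε (by linarith))
      (norm_nonneg _) (by norm_num)
  have hJi : ∀ (R : Measure ℝ) [IsFiniteMeasure R], IntervalIntegrable
      (fun s => J R (ε * s + u)) volume (-1) 1 := fun R _ =>
    ((hJc R).comp (by fun_prop : Continuous fun s : ℝ => ε * s + u)).intervalIntegrable _ _
  rw [integral_sinc_sq_mul_exp, integral_sinc_sq_mul_exp]
  change ‖2⁻¹ * (∫ s in (-1 : ℝ)..1, J P (ε * s + u)) -
    2⁻¹ * ∫ s in (-1 : ℝ)..1, J Q (ε * s + u)‖ ≤ _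
  rw [← mul_sub, ← intervalIntegral.integral_sub (hJi P) (hJi Q), norm_mul]
  have hb := intervalIntegral.norm_integral_le_of_norm_le_const
    (a := (-1 : ℝ)) (b := 1) (f := fun s => J P (ε * s + u) - J Q (ε * s + u))
    (C := 2⁻¹ * (ε⁻¹ * ∫ t in -K..K, ‖charFun P t - charFun Q t‖)) (fun s hs => by
      refine hJd _ ?_
      rw [uIoc_of_le (by norm_num)] at hs
      have h1 : |ε * s| ≤ ε := by
        rw [abs_mul, abs_of_pos hε]
        exact mul_le_of_le_one_right hε.le (abs_le.2 ⟨hs.1.le, hs.2⟩)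
      exact (abs_add_le _ _).trans (by linarith))
  have h2 : ‖(2⁻¹ : ℂ)‖ = 2⁻¹ := by simp
  rw [h2]
  have h3 : |(1 : ℝ) - -1| = 2 := by norm_num
  rw [h3] at hb
  linarith [(norm_nonneg _).trans hb]

/-- Both `sinc² y` and `y² sinc² y = sin² y` are at most `1`, so `2 / (1 + y²)` dominates. -/
theorem integrable_sinc_sq {ε : ℝ} (hε : 0 < ε) : Integrable fun x => Real.sinc (ε * x) ^ 2 := by
  have h1 : Integrable fun x : ℝ => 2 * (1 + (ε * x) ^ 2)⁻¹ :=
    (integrable_inv_one_add_sq.comp_mul_left' hε.ne').const_mul 2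
  refine h1.mono' ((Real.continuous_sinc.comp (by fun_prop)).pow 2).aestronglyMeasurable
    (ae_of_all _ fun x => ?_)
  generalize ε * x = y
  rw [Real.norm_eq_abs, abs_of_nonneg (sq_nonneg _), ← div_eq_mul_inv, le_div_iff₀ (by positivity)]
  have h2 : Real.sinc y ^ 2 ≤ 1 := (sq_le_one_iff_abs_le_one _).2 (Real.abs_sinc_le_one y)
  have h3 : (Real.sinc y * y) ^ 2 ≤ 1 := by
    rcases eq_or_ne y 0 with rfl | hy
    · simp
    · rw [Real.sinc_of_ne_zero hy, div_mul_cancel₀ _ hy]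
      exact Real.sin_sq_le_one y
  nlinarith

theorem half_le_sinc {y : ℝ} (hy : |y| ≤ 1) : 1 / 2 ≤ Real.sinc y := by
  have key : ∀ z : ℝ, 0 < z → z ≤ 1 → 1 / 2 ≤ Real.sinc z := by
    intro z hz hz1
    rw [Real.sinc_of_ne_zero hz.ne', le_div_iff₀ hz]
    have := Real.sin_gt_sub_cube hz
    nlinarith [mul_pos hz hz, pow_pos hz 3, mul_nonneg hz.le (sub_nonneg.2 hz1)]
  rcases lt_trichotomy y 0 with h | rfl | h
  · rw [← Real.sinc_neg]
    exact key _ (by linarith) (by linarith [(abs_le.1 hy).1])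
  · norm_num
  · exact key _ h (abs_le.1 hy).2

/-! ### Local limit theorem by comparison with a wide Gaussian -/

/-- `A n` times the density of variance `A n ^ 2` is `exp (-x² / (2 A n ²)) / √(2π)`, which is
bounded by and converges pointwise to `1 / √(2π)`; dominated convergence with bound `‖g‖` applies.
-/
theorem tendsto_mul_integral_gaussianReal {A : ℕ → ℝ} (hA0 : ∀ n, 0 ≤ A n)
    (hA : Tendsto A atTop atTop) {g : ℝ → ℂ} (hg : Integrable g) :
    Tendsto (fun n => (A n : ℂ) * ∫ x, g x ∂(ProbabilityTheory.gaussianReal 0 ((A n).toNNReal ^ 2)))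
      atTop (𝓝 (((√(2 * Real.pi))⁻¹ : ℝ) * ∫ x, g x)) := by
  have h1 : Tendsto (fun n => ∫ x, Real.exp (-x ^ 2 / (2 * A n ^ 2)) • g x) atTop
      (𝓝 (∫ x, g x)) := by
    refine tendsto_integral_filter_of_dominated_convergence (fun x => ‖g x‖)
      (Eventually.of_forall fun n => ?_) (Eventually.of_forall fun n => ae_of_all _ fun x => ?_)
      hg.norm (ae_of_all _ fun x => ?_)
    · have hc : Continuous fun x : ℝ => Real.exp (-x ^ 2 / (2 * A n ^ 2)) := by fun_prop
      exact hc.aestronglyMeasurable.smul hg.aestronglyMeasurable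
    · rw [norm_smul, Real.norm_eq_abs, Real.abs_exp]
      refine mul_le_of_le_one_left (norm_nonneg _) (Real.exp_le_one_iff.2 ?_)
      exact div_nonpos_of_nonpos_of_nonneg (by nlinarith [sq_nonneg x]) (by positivity)
    · have h2 : Tendsto (fun n => -x ^ 2 / (2 * A n ^ 2)) atTop (𝓝 0) :=
        Tendsto.div_atTop tendsto_const_nhds
          (((tendsto_pow_atTop two_ne_zero).comp hA).const_mul_atTop two_pos)
      have h3 := ((Real.continuous_exp.tendsto _).comp h2).smul_const (g x)
      simpa using h3
  refine (h1.const_mul (((√(2 * Real.pi))⁻¹ : ℝ) : ℂ)).congr' ?_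
  filter_upwards [hA.eventually_gt_atTop 0] with n hn
  have hv : (A n).toNNReal ^ 2 ≠ 0 := pow_ne_zero _ (Real.toNNReal_pos.2 hn).ne'
  rw [ProbabilityTheory.integral_gaussianReal_eq_integral_smul hv, ← integral_const_mul,
    ← integral_const_mul]
  congr 1 with x
  rw [ProbabilityTheory.gaussianPDFReal_def]
  simp only [NNReal.coe_pow, Real.coe_toNNReal _ (hA0 n), sub_zero, Complex.real_smul]
  rw [Real.sqrt_mul (by positivity) (A n ^ 2), Real.sqrt_sq hn.le]
  have : (A n : ℂ) ≠ 0 := Complex.ofReal_ne_zero.2 hn.ne'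
  push_cast
  field_simp

/-- Local limit theorem on measurable sets. -/
theorem tendsto_mul_real_of_tendsto_integral_charFun {P : ℕ → Measure ℝ}
    [∀ n, IsProbabilityMeasure (P n)] {A : ℕ → ℝ} (hA0 : ∀ n, 0 ≤ A n)
    (hA : Tendsto A atTop atTop)
    (hL : ∀ K : ℝ, 0 ≤ K → Tendsto (fun n => A n * ∫ t in -K..K,
      ‖charFun (P n) t - Complex.exp (-((A n : ℂ) ^ 2 * t ^ 2 / 2))‖) atTop (𝓝 0))
    {B : Set ℝ} (hB : MeasurableSet B) (hBb : Bornology.IsBounded B)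
    (hBf : volume (frontier B) = 0) :
    Tendsto (fun n => A n * (P n).real B) atTop (𝓝 ((√(2 * Real.pi))⁻¹ * volume.real B)) := by
  obtain ⟨R, hR⟩ := hBb.exists_norm_le
  have hR1 : 0 < |R| + 1 := by positivity
  -- This scale gives `|ε * x| ≤ 1` on `B`, where `sinc ≥ 1 / 2` and the weight is at least `1 / 4`.
  -- The absolute value is there because `R` may be negative when `B` is empty.
  set ε := (|R| + 1)⁻¹ with hε_def
  have hε : 0 < ε := inv_pos.2 hR1
  refine tendsto_mul_real_of_tendsto_weighted_charFun (w := fun x => Real.sinc (ε * x) ^ 2) hA0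
    ((Real.continuous_sinc.comp (by fun_prop)).pow 2) (fun x => sq_nonneg _)
    (fun x => (sq_le_one_iff_abs_le_one _).2 (Real.abs_sinc_le_one _)) (integrable_sinc_sq hε)
    (by positivity) (fun u => ?_) hB hBf (d := 1 / 4) (by norm_num) (fun x hx => ?_)
    ⟨0, by simp⟩
  · have e : ∀ x : ℝ, ((Real.sinc (ε * x) ^ 2 : ℝ) : ℂ) * Complex.exp (u * x * Complex.I) =
        (Real.sinc (ε * x) ^ 2 : ℂ) * Complex.exp ((u * x : ℝ) * Complex.I) := fun x => by
      push_cast; rfl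
    simp_rw [e]
    have hg : Integrable fun x => (Real.sinc (ε * x) ^ 2 : ℂ) *
        Complex.exp ((u * x : ℝ) * Complex.I) := by
      refine (integrable_sinc_sq hε).mono' (Continuous.aestronglyMeasurable ?_)
        (ae_of_all _ fun x => ?_)
      · exact ((Complex.continuous_ofReal.comp (Real.continuous_sinc.comp (by fun_prop))).pow 2).mul
          (continuous_exp_ofReal_mul_I u)
      · rw [norm_mul, Complex.norm_exp_ofReal_mul_I, mul_one, norm_pow, Complex.norm_real,
          Real.norm_eq_abs, sq_abs]
    have hG := tendsto_mul_integral_gaussianReal hA0 hA hg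
    set K := |u| + 2 * ε
    have hz : Tendsto (fun n => (A n : ℂ) * ((∫ x, (Real.sinc (ε * x) ^ 2 : ℂ) *
        Complex.exp ((u * x : ℝ) * Complex.I) ∂(P n)) - ∫ x, (Real.sinc (ε * x) ^ 2 : ℂ) *
        Complex.exp ((u * x : ℝ) * Complex.I)
          ∂(ProbabilityTheory.gaussianReal 0 ((A n).toNNReal ^ 2)))) atTop (𝓝 0) := by
      have h0 := (hL K (by positivity)).const_mul ε⁻¹
      rw [mul_zero] at h0
      refine squeeze_zero_norm (fun n => ?_) h0
      rw [norm_mul, Complex.norm_real, Real.norm_eq_abs, abs_of_nonneg (hA0 n), mul_left_comm]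
      refine mul_le_mul_of_nonneg_left ?_ (hA0 n)
      refine (norm_integral_sinc_sq_sub_le _ _ hε le_rfl).trans_eq ?_
      congr 2 with t
      rw [ProbabilityTheory.charFun_gaussianReal]
      simp [Real.coe_toNNReal _ (hA0 n)]
    have := hz.add hG
    rw [zero_add] at this
    refine this.congr fun n => ?_
    ring
  · have h1 : |ε * x| ≤ 1 := by
      rw [abs_mul, abs_of_pos hε, hε_def, inv_mul_le_iff₀ hR1]
      have := hR x hx
      rw [Real.norm_eq_abs] at this
      linarith [le_abs_self R]
    have := half_le_sinc h1
    nlinarith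

/-! ### `L¹` comparison with the Gaussian, and uniform integrability -/

/-- The substitution `t = A n * s` absorbs the prefactor `A n` for every Gaussian error term,
including the one from replacing `v n` by `1`; these vanish by dominated convergence. The uniform
error contributes only `2 K A n δ n`. -/
theorem tendsto_mul_integral_norm_sub_gaussian {φ : ℕ → ℝ → ℂ} (hφ : ∀ n, Continuous (φ n))
    {A : ℕ → ℝ} (hA : Tendsto A atTop atTop) {K : ℝ} (hK : 0 ≤ K) {v η δ : ℕ → ℝ}
    (hv : Tendsto v atTop (𝓝 1)) (hη : Tendsto η atTop (𝓝 0))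
    (hδ : Tendsto (fun n => A n * δ n) atTop (𝓝 0))
    (hb : ∀ᶠ n in atTop, ∀ s, |s| ≤ K →
      ‖φ n s - Complex.exp (-((A n : ℂ) ^ 2 * s ^ 2 * v n / 2))‖ ≤
        Real.exp (-(A n ^ 2 * s ^ 2 * v n / 2)) * η n + δ n) :
    Tendsto (fun n => A n * ∫ s in -K..K,
      ‖φ n s - Complex.exp (-((A n : ℂ) ^ 2 * s ^ 2 / 2))‖) atTop (𝓝 0) := by
  set g : ℕ → ℝ → ℝ := fun n t => Real.exp (-(t ^ 2 * v n / 2)) * |η n| +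
    |Real.exp (-(t ^ 2 * v n / 2)) - Real.exp (-(t ^ 2 / 2))| with hg_def
  have hgc : ∀ n, Continuous (g n) := fun n => by simp only [hg_def]; fun_prop
  -- Once `v n ≥ 1 / 2`, the function `exp (-t² / 4)` dominates all the Gaussians involved.
  have hexpv : ∀ᶠ n in atTop, ∀ t : ℝ,
      Real.exp (-(t ^ 2 * v n / 2)) ≤ Real.exp (-(1 / 4) * t ^ 2) := by
    filter_upwards [hv.eventually_const_le (show (1 / 2 : ℝ) < 1 by norm_num)] with n hn t
    exact Real.exp_le_exp.2 (by nlinarith [sq_nonneg t])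
  have hgb : ∀ᶠ n in atTop, ∀ t, ‖g n t‖ ≤ 3 * Real.exp (-(1 / 4) * t ^ 2) := by
    have hη1 : ∀ᶠ n in atTop, |η n| ≤ 1 := by
      have := hη.abs
      rw [abs_zero] at this
      exact this.eventually_le_const one_pos
    filter_upwards [hexpv, hη1] with n hn h1 t
    have h2 : Real.exp (-(t ^ 2 / 2)) ≤ Real.exp (-(1 / 4) * t ^ 2) :=
      Real.exp_le_exp.2 (by nlinarith [sq_nonneg t])
    have h3 := hn t
    have p1 := Real.exp_pos (-(t ^ 2 * v n / 2))
    have p2 := Real.exp_pos (-(t ^ 2 / 2))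
    rw [Real.norm_eq_abs, abs_of_nonneg (by positivity)]
    have h4 : |Real.exp (-(t ^ 2 * v n / 2)) - Real.exp (-(t ^ 2 / 2))| ≤
        2 * Real.exp (-(1 / 4) * t ^ 2) := by
      rw [abs_le]; constructor <;> linarith
    have h5 := mul_le_of_le_one_right p1.le h1
    simp only [hg_def]
    linarith
  have hint : Integrable fun t : ℝ => 3 * Real.exp (-(1 / 4) * t ^ 2) :=
    (integrable_exp_neg_mul_sq (by norm_num)).const_mul 3
  have hg0 : Tendsto (fun n => ∫ t, g n t) atTop (𝓝 0) := by
    have := tendsto_integral_filter_of_dominated_convergence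
      (f := fun _ : ℝ => (0 : ℝ)) (μ := volume) (F := g) (l := atTop)
      (fun t => 3 * Real.exp (-(1 / 4) * t ^ 2))
      (Eventually.of_forall fun n => (hgc n).aestronglyMeasurable)
      (hgb.mono fun n hn => ae_of_all _ hn) hint (ae_of_all _ fun t => by
        have h1 : Tendsto (fun n => Real.exp (-(t ^ 2 * v n / 2))) atTop
            (𝓝 (Real.exp (-(t ^ 2 / 2)))) := by
          refine (Real.continuous_exp.tendsto _).comp ?_
          have := ((hv.const_mul (t ^ 2)).div_const 2).neg
          rwa [mul_one] at this
        have h2 := (h1.mul hη.abs).add (h1.sub_const (Real.exp (-(t ^ 2 / 2)))).abs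
        simpa using h2)
    simpa using this
  have hδ' : Tendsto (fun n => |A n * δ n| * (2 * K)) atTop (𝓝 0) := by
    simpa using hδ.abs.mul_const (2 * K)
  have hsum := hg0.add hδ'
  rw [add_zero] at hsum
  refine squeeze_zero' ?_ ?_ hsum
  · filter_upwards [hA.eventually_ge_atTop 0] with n hn
    exact mul_nonneg hn (intervalIntegral.integral_nonneg (by linarith) fun s _ => norm_nonneg _)
  filter_upwards [hA.eventually_gt_atTop 0, hb, hgb] with n hn hbn hgbn
  have hgi : Integrable (g n) := hint.mono' (hgc n).aestronglyMeasurable (ae_of_all _ hgbn)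
  have hgci : Continuous fun s => g n (A n * s) := (hgc n).comp (by fun_prop)
  have h1 : ∫ s in -K..K, ‖φ n s - Complex.exp (-((A n : ℂ) ^ 2 * s ^ 2 / 2))‖ ≤
      ∫ s in -K..K, (g n (A n * s) + |δ n|) := by
    refine intervalIntegral.integral_mono_on (by linarith) ?_ ?_ fun s hs => ?_
    · refine Continuous.intervalIntegrable ?_ _ _
      have := hφ n
      fun_prop
    · exact (hgci.add continuous_const).intervalIntegrable _ _
    · have hc : Complex.exp (-((A n : ℂ) ^ 2 * s ^ 2 * v n / 2)) -
          Complex.exp (-((A n : ℂ) ^ 2 * s ^ 2 / 2)) =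
          ((Real.exp (-((A n * s) ^ 2 * v n / 2)) - Real.exp (-((A n * s) ^ 2 / 2)) : ℝ) : ℂ) := by
        push_cast
        ring_nf
      have hb' := hbn s (abs_le.2 ⟨hs.1, hs.2⟩)
      rw [← sub_add_sub_cancel _ (Complex.exp (-((A n : ℂ) ^ 2 * s ^ 2 * v n / 2)))]
      refine (norm_add_le _ _).trans ?_
      rw [hc, Complex.norm_real, Real.norm_eq_abs]
      simp only [hg_def]
      have e : Real.exp (-(A n ^ 2 * s ^ 2 * v n / 2)) = Real.exp (-((A n * s) ^ 2 * v n / 2)) := by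
        ring_nf
      rw [e] at hb'
      have h6 := mul_le_mul_of_nonneg_left (le_abs_self (η n))
        (Real.exp_pos (-((A n * s) ^ 2 * v n / 2))).le
      linarith [le_abs_self (δ n)]
  have h2 : ∫ s in -K..K, g n (A n * s) ≤ (A n)⁻¹ * ∫ t, g n t := by
    have h3 := Measure.integral_comp_mul_left (g n) (A n)
    rw [abs_of_pos (inv_pos.2 hn), smul_eq_mul] at h3
    rw [← h3, intervalIntegral.integral_of_le (by linarith)]
    refine setIntegral_le_integral (hgi.comp_mul_left' hn.ne') (ae_of_all _ fun s => ?_)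
    simp only [hg_def, Pi.zero_apply]
    positivity
  rw [intervalIntegral.integral_add (hgci.intervalIntegrable _ _) (by simp),
    intervalIntegral.integral_const, smul_eq_mul] at h1
  have h4 := mul_le_mul_of_nonneg_left (h1.trans (add_le_add_left h2 _)) hn.le
  refine h4.trans_eq ?_
  rw [mul_add, mul_inv_cancel_left₀ hn.ne', abs_mul, abs_of_pos hn]
  ring

theorem uniformlyIntegrableOnLine_of_tendsto_eLpNorm {F : ℕ → ℝ → ℂ} {G : ℝ → ℂ}
    (hF : ∀ n, MemLp (F n) 1 volume) (hG : MemLp G 1 volume)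
    (h : Tendsto (fun n => eLpNorm (F n - G) 1 volume) atTop (𝓝 0)) :
    UniformlyIntegrableOnLine F := by
  obtain ⟨-, h1, h2⟩ := (tendstoInMeasure_iff_tendsto_Lp le_rfl ENNReal.one_ne_top hF hG).2 h
  refine ⟨⟨fun n => (hF n).1, h1, ?_⟩, h2⟩
  have hfin : ∀ n, eLpNorm (F n) 1 volume ≠ ⊤ := fun n => (hF n).2.ne
  obtain ⟨N, hN⟩ := eventually_atTop.1 (h.eventually_le_const (show (0 : ENNReal) < 1 by simp))
  -- The finitely many norms before `N` are bounded by their sum, the later ones by `1 + ‖G‖₁`.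
  refine ⟨∑ n ∈ Finset.range N, (eLpNorm (F n) 1 volume).toNNReal +
    (1 + (eLpNorm G 1 volume).toNNReal), fun n => ?_⟩
  push_cast
  rw [ENNReal.coe_toNNReal hG.2.ne, Finset.sum_congr rfl
    fun k _ => ENNReal.coe_toNNReal (hfin k)]
  rcases lt_or_ge n N with hn | hn
  · exact (Finset.single_le_sum (f := fun k => eLpNorm (F k) 1 volume) (fun _ _ => zero_le)
      (Finset.mem_range.2 hn)).trans le_self_add
  · have h3 : eLpNorm (F n) 1 volume ≤ eLpNorm (F n - G) 1 volume + eLpNorm G 1 volume := by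
      simpa using eLpNorm_add_le ((hF n).sub hG).1 hG.1 le_rfl
    exact (h3.trans (add_le_add_left (hN n hn) _)).trans le_add_self

/-- The truncated functions converge in `L¹` to `exp (-t² / 2)`: inside the window the distance is
the integral in `hL` after rescaling, outside it is a Gaussian tail. -/
theorem uniformlyIntegrableOnLine_indicator_of_tendsto {φ : ℕ → ℝ → ℂ}
    (hφ : ∀ n, Continuous (φ n))
    {A : ℕ → ℝ} (hA : Tendsto A atTop atTop) {K : ℝ} (hK : 0 ≤ K)
    (hL : Tendsto (fun n => A n * ∫ s in -K..K,
      ‖φ n s - Complex.exp (-((A n : ℂ) ^ 2 * s ^ 2 / 2))‖) atTop (𝓝 0)) :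
    UniformlyIntegrableOnLine fun n =>
      {t : ℝ | |t| ≤ A n * K}.indicator fun t => φ n (t / A n) := by
  have hset : ∀ n, {t : ℝ | |t| ≤ A n * K} = Icc (-(A n * K)) (A n * K) := fun n => by
    ext t; simp [abs_le]
  have hmem : ∀ n, MemLp ({t : ℝ | |t| ≤ A n * K}.indicator fun t => φ n (t / A n)) 1 volume := by
    intro n
    have hc : Continuous fun t : ℝ => φ n (t / A n) := (hφ n).comp (by fun_prop)
    rw [hset, memLp_one_iff_integrable, integrable_indicator_iff measurableSet_Icc]
    exact hc.integrableOn_Icc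
  -- For `K = 0` the window is the single point `0` and does not grow, so the `L¹` limit is `0` and
  -- not the Gaussian.
  rcases hK.eq_or_lt with rfl | hK
  · refine uniformlyIntegrableOnLine_of_tendsto_eLpNorm (G := 0) hmem MemLp.zero ?_
    refine tendsto_const_nhds.congr fun n => ?_
    rw [sub_zero, eq_comm, eLpNorm_eq_zero_iff (hmem n).1 one_ne_zero]
    have h0 : {t : ℝ | |t| ≤ A n * 0} = {0} := by ext t; simp
    rw [h0]
    exact indicator_meas_zero (by simp)
  set G : ℝ → ℂ := fun t => Complex.exp (-((t : ℂ) ^ 2 / 2)) with hG_def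
  have hGc : Continuous G := by simp only [hG_def]; fun_prop
  have hGr : ∀ t, ‖G t‖ = Real.exp (-(1 / 2) * t ^ 2) := fun t => by
    have : G t = ((Real.exp (-(1 / 2) * t ^ 2) : ℝ) : ℂ) := by
      simp only [hG_def]; push_cast; ring_nf
    rw [this, Complex.norm_real, Real.norm_eq_abs, Real.abs_exp]
  have hGi : Integrable G := by
    rw [← integrable_norm_iff hGc.aestronglyMeasurable]
    simp_rw [hGr]
    exact integrable_exp_neg_mul_sq (by norm_num)
  have hGm : MemLp G 1 volume := memLp_one_iff_integrable.2 hGi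
  refine uniformlyIntegrableOnLine_of_tendsto_eLpNorm hmem hGm ?_
  have htail : Tendsto (fun n => ∫ t in {t : ℝ | |t| ≤ A n * K}ᶜ, ‖G t‖) atTop (𝓝 0) := by
    have := tendsto_integral_filter_of_dominated_convergence (μ := volume) (l := atTop)
      (F := fun n => {t : ℝ | |t| ≤ A n * K}ᶜ.indicator fun t => ‖G t‖) (f := fun _ => (0 : ℝ))
      (fun t => ‖G t‖) (Eventually.of_forall fun n => ?_) (Eventually.of_forall fun n =>
        ae_of_all _ fun t => ?_) hGi.norm (ae_of_all _ fun t => ?_)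
    · simp only [integral_zero] at this
      refine this.congr fun n => ?_
      rw [integral_indicator]
      rw [hset]; exact measurableSet_Icc.compl
    · rw [hset]
      exact hGc.norm.aestronglyMeasurable.indicator measurableSet_Icc.compl
    · exact (norm_indicator_le_norm_self _ _).trans (by simp)
    · refine tendsto_const_nhds.congr' ?_
      filter_upwards [(hA.atTop_mul_const hK).eventually_ge_atTop |t|] with n hn
      rw [indicator_of_notMem]
      simpa using hn
  have hsum : Tendsto (fun n => ENNReal.ofReal ((A n * ∫ s in -K..K,
      ‖φ n s - Complex.exp (-((A n : ℂ) ^ 2 * s ^ 2 / 2))‖) +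
      ∫ t in {t : ℝ | |t| ≤ A n * K}ᶜ, ‖G t‖)) atTop (𝓝 0) := by
    have := hL.add htail
    rw [add_zero] at this
    simpa using ENNReal.tendsto_ofReal this
  refine hsum.congr' ?_
  filter_upwards [hA.eventually_gt_atTop 0] with n hn
  have hi : Integrable (({t : ℝ | |t| ≤ A n * K}.indicator fun t => φ n (t / A n)) - G) :=
    (memLp_one_iff_integrable.1 (hmem n)).sub hGi
  rw [eLpNorm_one_eq_lintegral_enorm, ← ofReal_integral_norm_eq_lintegral_enorm hi]
  congr 1
  have hms : MeasurableSet {t : ℝ | |t| ≤ A n * K} := by rw [hset]; exact measurableSet_Icc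
  rw [← integral_add_compl hms hi.norm]
  congr 1
  · have h1 : ∫ t in {t : ℝ | |t| ≤ A n * K},
        ‖(({t : ℝ | |t| ≤ A n * K}.indicator fun t => φ n (t / A n)) - G) t‖ =
        ∫ t in {t : ℝ | |t| ≤ A n * K}, ‖φ n (t / A n) - G t‖ :=
      setIntegral_congr_fun hms fun t ht => by
        simp only [Pi.sub_apply, indicator_of_mem ht]
    have h2 := intervalIntegral.integral_comp_div (a := -(A n * K)) (b := A n * K)
      (fun s => ‖φ n s - Complex.exp (-((A n : ℂ) ^ 2 * s ^ 2 / 2))‖) hn.ne'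
    rw [neg_div, mul_div_cancel_left₀ _ hn.ne', smul_eq_mul] at h2
    rw [h1, ← h2, hset, integral_Icc_eq_integral_Ioc, intervalIntegral.integral_of_le
      (by nlinarith)]
    refine setIntegral_congr_fun measurableSet_Ioc fun t _ => ?_
    have hn' : (A n : ℂ) ≠ 0 := Complex.ofReal_ne_zero.2 hn.ne'
    simp only [hG_def]
    congr 4
    push_cast
    field_simp
  · refine setIntegral_congr_fun hms.compl fun t ht => ?_
    simp only [Pi.sub_apply, indicator_of_notMem ht, zero_sub, norm_neg]

/-! ### Both conclusions from one estimate on characteristic functions -/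

theorem expChar_eq_charFun {Ω : Type*} [MeasurableSpace Ω] {P : Measure Ω} {X : Ω → ℝ}
    (hX : AEMeasurable X P) (t : ℝ) : expChar P X t = charFun (P.map X) t := by
  rw [charFun_apply_real, integral_map hX (Continuous.aestronglyMeasurable (by fun_prop)), expChar]
  push_cast
  rfl

/-- Mod-Gaussian convergence together with the local limit theorem, from a quantitative comparison
of characteristic functions with Gaussian ones on compact intervals. -/
theorem convergesModGaussianWeak_and_local_limit {Ω : Type*} [MeasurableSpace Ω] {P : Measure Ω}
    [IsProbabilityMeasure P] {X : ℕ → Ω → ℝ} (hX : ∀ n, AEMeasurable (X n) P) {A : ℕ → ℝ}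
    (hA0 : ∀ n, 0 ≤ A n) (hA : Tendsto A atTop atTop) {v : ℕ → ℝ} (hv : Tendsto v atTop (𝓝 1))
    (hb : ∀ K : ℝ, 0 ≤ K → ∃ η δ : ℕ → ℝ, Tendsto η atTop (𝓝 0) ∧
      Tendsto (fun n => A n * δ n) atTop (𝓝 0) ∧ ∀ᶠ n in atTop, ∀ s, |s| ≤ K →
      ‖expChar P (X n) s - Complex.exp (-((A n : ℂ) ^ 2 * s ^ 2 * v n / 2))‖ ≤
        Real.exp (-(A n ^ 2 * s ^ 2 * v n / 2)) * η n + δ n) :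
    ConvergesModGaussianWeak P X A ∧ ∀ B : Set ℝ, IsBoundedJordanMeasurable B →
      Tendsto (fun n => A n * P.real (X n ⁻¹' B)) atTop
        (𝓝 (volume.real B / √(2 * Real.pi))) := by
  have hprob : ∀ n, IsProbabilityMeasure (P.map (X n)) := fun n =>
    Measure.isProbabilityMeasure_map (hX n)
  have hL : ∀ K : ℝ, 0 ≤ K → Tendsto (fun n => A n * ∫ s in -K..K,
      ‖charFun (P.map (X n)) s - Complex.exp (-((A n : ℂ) ^ 2 * s ^ 2 / 2))‖) atTop (𝓝 0) := by
    intro K hK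
    obtain ⟨η, δ, hη, hδ, h⟩ := hb K hK
    refine tendsto_mul_integral_norm_sub_gaussian (fun n => continuous_charFun) hA hK hv hη hδ ?_
    simpa only [expChar_eq_charFun (hX _)] using h
  refine ⟨⟨hX, hA, fun t => ?_, fun K hK => ?_⟩, fun B hB => ?_⟩
  -- The bound `K = 1` suffices, since `|t / A n| ≤ 1` eventually for each fixed `t`.
  · obtain ⟨η, δ, hη, hδ, h⟩ := hb 1 zero_le_one
    have hexp : Tendsto (fun n => Real.exp (-(t ^ 2 * v n / 2))) atTop
        (𝓝 (Real.exp (-(t ^ 2 / 2)))) := by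
      refine (Real.continuous_exp.tendsto _).comp ?_
      have := ((hv.const_mul (t ^ 2)).div_const 2).neg
      rwa [mul_one] at this
    have hδ0 : Tendsto δ atTop (𝓝 0) := by
      have := hδ.mul hA.inv_tendsto_atTop
      rw [mul_zero] at this
      refine this.congr' ?_
      filter_upwards [hA.eventually_gt_atTop 0] with n hn
      simp only [Pi.inv_apply]
      field_simp
    have hz : Tendsto (fun n => expChar P (X n) (t / A n) -
        ((Real.exp (-(t ^ 2 * v n / 2)) : ℝ) : ℂ)) atTop (𝓝 0) := by
      have h0 := (hexp.mul hη).add hδ0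
      rw [mul_zero, add_zero] at h0
      refine squeeze_zero_norm' ?_ h0
      filter_upwards [h, hA.eventually_gt_atTop 0, hA.eventually_ge_atTop |t|] with n h1 hn ht
      have h2 := h1 (t / A n) (by rw [abs_div, abs_of_pos hn]; exact (div_le_one hn).2 ht)
      have e : A n ^ 2 * (t / A n) ^ 2 * v n / 2 = t ^ 2 * v n / 2 := by field_simp
      have e' : Complex.exp (-((A n : ℂ) ^ 2 * ((t / A n : ℝ) : ℂ) ^ 2 * v n / 2)) =
          ((Real.exp (-(t ^ 2 * v n / 2)) : ℝ) : ℂ) := by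
        rw [← e]; push_cast; rfl
      rwa [e, e'] at h2
    have := hz.add ((Complex.continuous_ofReal.tendsto _).comp hexp)
    rw [zero_add] at this
    convert this using 2
    · simp
    · push_cast; rfl
  · simp_rw [expChar_eq_charFun (hX _)]
    exact uniformlyIntegrableOnLine_indicator_of_tendsto (φ := fun n => charFun (P.map (X n)))
      (fun n => continuous_charFun) hA hK (hL K hK)
  · obtain ⟨hBb, hBf⟩ := hB
    -- `B` need not be Borel, so it is squeezed between its interior and its closure, which have the
    -- same volume and null frontiers.
    have hBi : volume.real (interior B) = volume.real B :=
      measureReal_congr (interior_ae_eq_of_null_frontier hBf)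
    have hBc : volume.real (closure B) = volume.real B :=
      measureReal_congr (closure_ae_eq_of_null_frontier hBf)
    have h1 := tendsto_mul_real_of_tendsto_integral_charFun hA0 hA hL
      isOpen_interior.measurableSet (hBb.subset interior_subset)
      (measure_mono_null frontier_interior_subset hBf)
    have h2 := tendsto_mul_real_of_tendsto_integral_charFun hA0 hA hL
      isClosed_closure.measurableSet hBb.closure
      (measure_mono_null frontier_closure_subset hBf)
    rw [hBi, inv_mul_eq_div] at h1
    rw [hBc, inv_mul_eq_div] at h2
    refine tendsto_of_tendsto_of_tendsto_of_le_of_le h1 h2 (fun n => ?_) fun n => ?_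
    · rw [map_measureReal_apply_of_aemeasurable (hX n) isOpen_interior.measurableSet]
      exact mul_le_mul_of_nonneg_left (measureReal_mono (preimage_mono interior_subset)) (hA0 n)
    · rw [map_measureReal_apply_of_aemeasurable (hX n) isClosed_closure.measurableSet]
      exact mul_le_mul_of_nonneg_left (measureReal_mono (preimage_mono subset_closure)) (hA0 n)

/-! ### Exact independence of step functions along a divisibility chain -/

/-- After `y = M * x` the integral splits into `M` unit intervals; on each one `G` is constant off
the end points and `g` is integrated over a full period. -/
theorem integral_step_mul_periodic_eq_sum {M : ℕ} (hM : 0 < M) {G g : ℝ → ℂ}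
    (hG : ∀ x, G x = G ((⌊M * x⌋ : ℝ) / M)) (hg : Function.Periodic g 1)
    (hgi : ∀ a b, IntervalIntegrable g volume a b) :
    ∫ x in (0 : ℝ)..1, G x * g (M * x) =
      (M : ℝ)⁻¹ • ((∑ j ∈ Finset.range M, G (j / M)) * ∫ x in (0 : ℝ)..1, g x) := by
  have hM' : (M : ℝ) ≠ 0 := by positivity
  set Φ : ℝ → ℂ := fun y => G ((⌊y⌋ : ℝ) / M) * g y
  have h1 : ∫ x in (0 : ℝ)..1, G x * g (M * x) = ∫ x in (0 : ℝ)..1, Φ (M * x) := by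
    refine intervalIntegral.integral_congr fun x _ => ?_
    simp only [Φ]
    rw [hG x]
  have hcongr : ∀ j : ℕ, ∀ y ∈ Ioo (j : ℝ) ((j + 1 : ℕ) : ℝ), Φ y = G (j / M) * g y := by
    intro j y hy
    have : ⌊y⌋ = (j : ℤ) := by
      rw [Int.floor_eq_iff]
      push_cast
      have := hy.2
      push_cast at this
      exact ⟨hy.1.le, this⟩
    simp only [Φ, this, Int.cast_natCast]
  have hle : ∀ j : ℕ, (j : ℝ) ≤ ((j + 1 : ℕ) : ℝ) := fun j => by push_cast; linarith
  have hΦi : ∀ j : ℕ, IntervalIntegrable Φ volume (j : ℝ) ((j + 1 : ℕ) : ℝ) := by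
    intro j
    rw [intervalIntegrable_iff_integrableOn_Ioo_of_le (hle j)]
    have h2 := (hgi j ((j + 1 : ℕ) : ℝ)).const_mul (G (j / M))
    rw [intervalIntegrable_iff_integrableOn_Ioo_of_le (hle j)] at h2
    exact h2.congr_fun (fun y hy => (hcongr j y hy).symm) measurableSet_Ioo
  have h3 : ∀ j : ℕ, ∫ y in (j : ℝ)..((j + 1 : ℕ) : ℝ), Φ y =
      G (j / M) * ∫ x in (0 : ℝ)..1, g x := by
    intro j
    have h4 := hg.intervalIntegral_add_eq (j : ℝ) 0
    rw [zero_add] at h4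
    rw [← h4, ← intervalIntegral.integral_const_mul, intervalIntegral.integral_of_le (hle j),
      intervalIntegral.integral_of_le (by linarith), integral_Ioc_eq_integral_Ioo,
      integral_Ioc_eq_integral_Ioo]
    have h5 := setIntegral_congr_fun (μ := volume) measurableSet_Ioo (hcongr j)
    rw [h5]
    push_cast
    rfl
  rw [h1, intervalIntegral.integral_comp_mul_left Φ hM', mul_zero, mul_one]
  have h6 := intervalIntegral.sum_integral_adjacent_intervals (a := fun j : ℕ => (j : ℝ)) (n := M)
    (fun k _ => hΦi k)
  simp only [Nat.cast_zero] at h6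
  rw [← h6, Finset.sum_congr rfl fun j _ => h3 j, Finset.sum_mul]

/-- A function constant on the intervals `[j / M, (j + 1) / M)` is independent of every function
of `M * x` that is periodic in `M * x`. -/
theorem integral_step_mul_periodic {M : ℕ} (hM : 0 < M) {G g : ℝ → ℂ}
    (hG : ∀ x, G x = G ((⌊M * x⌋ : ℝ) / M)) (hg : Function.Periodic g 1)
    (hgi : ∀ a b, IntervalIntegrable g volume a b) :
    ∫ x in (0 : ℝ)..1, G x * g (M * x) = (∫ x in (0 : ℝ)..1, G x) * ∫ x in (0 : ℝ)..1, g x := by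
  -- The case `g = 1` identifies the average of the samples of `G` with its integral.
  have h1 := integral_step_mul_periodic_eq_sum hM hG (g := fun _ => 1) (fun _ => rfl)
    (fun _ _ => intervalIntegrable_const)
  simp only [mul_one, intervalIntegral.integral_const, sub_zero, one_smul] at h1
  rw [integral_step_mul_periodic_eq_sum hM hG hg hgi, h1, smul_mul_assoc]

/-- Factor `k ≤ n` is constant on intervals of length `1 / (b k * M k) = 1 / M (k + 1)`, and `M (k +
1)` divides `M (n + 1)`. The product up to `n` is therefore a step function at scale `M (n + 1)`,
and the last factor splits off. -/
theorem integral_prod_step_periodic {M b : ℕ → ℕ} (hM : ∀ k, 1 ≤ k → 0 < M k)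
    (hb : ∀ k, 1 ≤ k → 0 < b k) (hMb : ∀ k, 1 ≤ k → M (k + 1) = b k * M k) {g : ℕ → ℝ → ℂ}
    (hg : ∀ k, 1 ≤ k → Function.Periodic (g k) 1)
    (hgs : ∀ k, 1 ≤ k → ∀ y, g k y = g k ((⌊b k * y⌋ : ℝ) / b k))
    (hgi : ∀ k, 1 ≤ k → ∀ x y, IntervalIntegrable (g k) volume x y) (n : ℕ) :
    ∫ x in (0 : ℝ)..1, ∏ k ∈ Finset.Icc 1 n, g k (M k * x) =
      ∏ k ∈ Finset.Icc 1 n, ∫ x in (0 : ℝ)..1, g k x := by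
  have hdvd : ∀ k, 1 ≤ k → ∀ n, k ≤ n → M (k + 1) ∣ M (n + 1) := by
    intro k hk n hn
    induction n, hn using Nat.le_induction with
    | base => exact dvd_rfl
    | succ n hn ih => exact ih.trans ⟨b (n + 1), by rw [hMb (n + 1) (by omega), mul_comm]⟩
  induction n with
  | zero => simp
  | succ n ih =>
    simp_rw [Finset.prod_Icc_succ_top (Nat.le_add_left 1 n)]
    rw [integral_step_mul_periodic (hM (n + 1) (by omega))
      (G := fun x => ∏ k ∈ Finset.Icc 1 n, g k (M k * x)) (fun x => ?_) (hg _ (by omega))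
      (hgi _ (by omega)), ih]
    refine Finset.prod_congr rfl fun k hk => ?_
    obtain ⟨hk1, hkn⟩ := Finset.mem_Icc.1 hk
    obtain ⟨q, hq⟩ := hdvd k hk1 n hkn
    have hN := hM (n + 1) (by omega)
    have hq0 : 0 < q := by
      rcases Nat.eq_zero_or_pos q with rfl | h
      · omega
      · exact h
    rw [hMb k hk1] at hq
    have hNr : (M (n + 1) : ℝ) = b k * M k * q := by rw [hq]; push_cast; ring
    have hq' : (q : ℝ) ≠ 0 := by positivity
    have hb' : (b k : ℝ) ≠ 0 := by have := hb k hk1; positivity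
    have hM' : (M k : ℝ) ≠ 0 := by have := hM k hk1; positivity
    rw [hgs k hk1 (M k * x), hgs k hk1 (M k * _)]
    congr 3
    -- Rounding at the finer scale first changes nothing, because `⌊⌊y⌋ / q⌋ = ⌊y / q⌋` for a
    -- positive integer `q`.
    have e1 : (b k : ℝ) * (M k * ((⌊(M (n + 1) : ℝ) * x⌋ : ℝ) / M (n + 1))) =
        (⌊(M (n + 1) : ℝ) * x⌋ : ℝ) / q := by
      rw [hNr]; field_simp
    have e2 : (b k : ℝ) * (M k * x) = ((M (n + 1) : ℝ) * x) / q := by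
      rw [hNr]; field_simp
    rw [e1, e2, Int.floor_div_natCast, Int.floor_div_natCast, Int.floor_intCast]

/-! ### Step approximation of a Hölder function -/

/-- The centred step function that samples `f` at the left end points of the intervals
`[j / b, (j + 1) / b)`. -/
noncomputable def stepApprox (f : ℝ → ℝ) (b : ℕ) (x : ℝ) : ℝ :=
  f ((⌊b * x⌋ : ℝ) / b) - ∫ y in (0 : ℝ)..1, f ((⌊b * y⌋ : ℝ) / b)

section StepApprox

variable {f : ℝ → ℝ} {b : ℕ}

theorem measurable_floor_sample (hf : Measurable f) (b : ℕ) :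
    Measurable fun x : ℝ => f ((⌊b * x⌋ : ℝ) / b) :=
  hf.comp (by fun_prop)

theorem measurable_stepApprox (hf : Measurable f) (b : ℕ) : Measurable (stepApprox f b) :=
  (measurable_floor_sample hf b).sub_const _

theorem periodic_stepApprox (hf : Function.Periodic f 1) (hb : 0 < b) :
    Function.Periodic (stepApprox f b) 1 := by
  intro x
  have hb' : (b : ℝ) ≠ 0 := by positivity
  have : ⌊(b : ℝ) * (x + 1)⌋ = ⌊(b : ℝ) * x⌋ + b := by
    rw [mul_add, mul_one, Int.floor_add_natCast]
  simp only [stepApprox, this]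
  push_cast
  rw [add_div, div_self hb', hf]

theorem stepApprox_floor (hb : 0 < b) (x : ℝ) :
    stepApprox f b x = stepApprox f b ((⌊b * x⌋ : ℝ) / b) := by
  have hb' : (b : ℝ) ≠ 0 := by positivity
  simp only [stepApprox, mul_div_cancel₀ _ hb', Int.floor_intCast]

theorem intervalIntegrable_of_measurable_bounded {g : ℝ → ℝ} (hg : Measurable g) {C : ℝ}
    (hC : ∀ x, |g x| ≤ C) (x y : ℝ) : IntervalIntegrable g volume x y :=
  (intervalIntegrable_const (c := C)).mono_fun' hg.aestronglyMeasurable (ae_of_all _ hC)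

theorem integral_stepApprox (hf : Measurable f) {C : ℝ} (hC : ∀ x, |f x| ≤ C) :
    ∫ x in (0 : ℝ)..1, stepApprox f b x = 0 := by
  simp only [stepApprox]
  rw [intervalIntegral.integral_sub
    (intervalIntegrable_of_measurable_bounded (measurable_floor_sample hf b) (fun _ => hC _) _ _)
    intervalIntegrable_const]
  simp

theorem abs_stepApprox_le {C : ℝ} (hC : ∀ x, |f x| ≤ C) (x : ℝ) : |stepApprox f b x| ≤ 2 * C := by
  have h1 := intervalIntegral.norm_integral_le_of_norm_le_const (a := (0 : ℝ)) (b := 1)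
    (f := fun y => f ((⌊b * y⌋ : ℝ) / b)) (C := C) fun y _ => hC _
  rw [sub_zero, abs_one, mul_one, Real.norm_eq_abs] at h1
  have := hC ((⌊b * x⌋ : ℝ) / b)
  exact (abs_sub _ _).trans (by linarith)

/-- The Hölder bound is available only inside one period, so `x` is reduced to its fractional part
`u`. The sample point is a left end point, hence stays in `[0, 1)` together with `u` and lies within
`1 / b` of it. -/
theorem abs_sub_floor_sample_le (hf : Function.Periodic f 1) {h α : ℝ} (hh : 0 ≤ h) (hα : 0 < α)
    (hol : ∀ x ∈ Ico (0 : ℝ) 1, ∀ y ∈ Ico (0 : ℝ) 1, |f x - f y| ≤ h * |x - y| ^ α)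
    (hb : 0 < b) (x : ℝ) : |f x - f ((⌊b * x⌋ : ℝ) / b)| ≤ h / (b : ℝ) ^ α := by
  have hb' : 0 < (b : ℝ) := by positivity
  have hx : x = Int.fract x + ⌊x⌋ := (Int.fract_add_floor x).symm
  set u := Int.fract x with hu
  have hu0 : 0 ≤ u := Int.fract_nonneg x
  have hu1 : u < 1 := Int.fract_lt_one x
  have hper : ∀ y, f (y + ⌊x⌋) = f y := fun y => by
    simpa using hf.int_mul ⌊x⌋ y
  have hfl : ((⌊(b : ℝ) * x⌋ : ℝ)) / b = (⌊(b : ℝ) * u⌋ : ℝ) / b + ⌊x⌋ := by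
    have : ⌊(b : ℝ) * x⌋ = ⌊(b : ℝ) * u⌋ + b * ⌊x⌋ := by
      conv_lhs => rw [hx]
      rw [mul_add, ← Int.floor_add_intCast]
      push_cast
      rfl
    rw [this]
    push_cast
    field_simp
  have hle : (⌊(b : ℝ) * u⌋ : ℝ) / b ≤ u := by
    rw [div_le_iff₀ hb', mul_comm u]; exact Int.floor_le _
  have hge : u - 1 / b ≤ (⌊(b : ℝ) * u⌋ : ℝ) / b := by
    have := (Int.sub_one_lt_floor ((b : ℝ) * u)).le
    rw [le_div_iff₀ hb', sub_mul, one_div, inv_mul_cancel₀ hb'.ne', mul_comm u]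
    exact this
  have h0 : 0 ≤ (⌊(b : ℝ) * u⌋ : ℝ) / b :=
    div_nonneg (Int.cast_nonneg (Int.floor_nonneg.2 (by positivity))) hb'.le
  rw [hfl, hper]
  conv_lhs => rw [hx, hper]
  refine (hol u ⟨hu0, hu1⟩ _ ⟨h0, hle.trans_lt hu1⟩).trans ?_
  rw [div_eq_mul_inv h, ← Real.inv_rpow hb'.le]
  refine mul_le_mul_of_nonneg_left (Real.rpow_le_rpow (abs_nonneg _) ?_ hα.le) hh
  rw [abs_of_nonneg (by linarith), ← one_div]
  linarith

/-- Sampling costs `h / b ^ α`; centring costs as much again, because `f` has mean zero and so the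
mean of the samples is itself an average of sampling errors. -/
theorem abs_sub_stepApprox_le (hfm : Measurable f) {C : ℝ} (hC : ∀ x, |f x| ≤ C)
    (hf : Function.Periodic f 1) {h α : ℝ} (hh : 0 ≤ h) (hα : 0 < α)
    (hol : ∀ x ∈ Ico (0 : ℝ) 1, ∀ y ∈ Ico (0 : ℝ) 1, |f x - f y| ≤ h * |x - y| ^ α)
    (hmean : ∫ x in (0 : ℝ)..1, f x = 0) (hb : 0 < b) (x : ℝ) :
    |f x - stepApprox f b x| ≤ 2 * h / (b : ℝ) ^ α := by
  have h1 := abs_sub_floor_sample_le hf hh hα hol hb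
  have h2 : |∫ y in (0 : ℝ)..1, f ((⌊b * y⌋ : ℝ) / b)| ≤ h / (b : ℝ) ^ α := by
    have h3 := intervalIntegral.norm_integral_le_of_norm_le_const (a := (0 : ℝ)) (b := 1)
      (f := fun y => f y - f ((⌊b * y⌋ : ℝ) / b)) fun y _ => h1 y
    rw [intervalIntegral.integral_sub (intervalIntegrable_of_measurable_bounded hfm hC _ _)
      (intervalIntegrable_of_measurable_bounded (measurable_floor_sample hfm b)
        (fun _ => hC _) _ _), hmean, zero_sub, norm_neg, sub_zero, abs_one, mul_one] at h3
    exact h3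
  have e : f x - stepApprox f b x =
      (f x - f ((⌊b * x⌋ : ℝ) / b)) + ∫ y in (0 : ℝ)..1, f ((⌊b * y⌋ : ℝ) / b) := by
    simp only [stepApprox]; ring
  rw [e]
  refine (abs_add_le _ _).trans ((add_le_add (h1 x) h2).trans_eq ?_)
  ring

theorem abs_integral_stepApprox_sq_sub_one_le (hfm : Measurable f) {C : ℝ} (hC : ∀ x, |f x| ≤ C)
    (hf : Function.Periodic f 1) {h α : ℝ} (hh : 0 ≤ h) (hα : 0 < α)
    (hol : ∀ x ∈ Ico (0 : ℝ) 1, ∀ y ∈ Ico (0 : ℝ) 1, |f x - f y| ≤ h * |x - y| ^ α)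
    (hmean : ∫ x in (0 : ℝ)..1, f x = 0) (hvar : ∫ x in (0 : ℝ)..1, f x ^ 2 = 1) (hb : 0 < b) :
    |(∫ x in (0 : ℝ)..1, stepApprox f b x ^ 2) - 1| ≤ 3 * C * (2 * h / (b : ℝ) ^ α) := by
  have hsq : ∀ {g : ℝ → ℝ} {D : ℝ}, Measurable g → (∀ x, |g x| ≤ D) →
      IntervalIntegrable (fun x => g x ^ 2) volume 0 1 := fun {g D} hg hD =>
    intervalIntegrable_of_measurable_bounded (hg.pow_const 2) (C := D ^ 2) (fun x => by
      rw [abs_pow]; exact pow_le_pow_left₀ (abs_nonneg _) (hD x) 2) _ _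
  have e1 : (∫ x in (0 : ℝ)..1, stepApprox f b x ^ 2) - 1 =
      (∫ x in (0 : ℝ)..1, stepApprox f b x ^ 2) - ∫ x in (0 : ℝ)..1, f x ^ 2 := by rw [hvar]
  rw [e1, ← intervalIntegral.integral_sub
    (hsq (measurable_stepApprox hfm b) (abs_stepApprox_le hC)) (hsq hfm hC)]
  have h3 := intervalIntegral.norm_integral_le_of_norm_le_const (a := (0 : ℝ)) (b := 1)
    (f := fun y => stepApprox f b y ^ 2 - f y ^ 2) (C := 3 * C * (2 * h / (b : ℝ) ^ α)) fun y _ => by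
      -- In the factor `stepApprox f b y + f y` the terms are at most `2 * C` and `C`, hence the
      -- constant `3 * C`.
      have e : stepApprox f b y ^ 2 - f y ^ 2 =
          -((stepApprox f b y + f y) * (f y - stepApprox f b y)) := by ring
      rw [e, norm_neg, norm_mul]
      refine mul_le_mul ((norm_add_le _ _).trans ?_)
        (abs_sub_stepApprox_le hfm hC hf hh hα hol hmean hb y) (norm_nonneg _) ?_
      · have := abs_stepApprox_le (b := b) hC y
        have := hC y
        simp only [Real.norm_eq_abs]
        linarith
      · linarith [(abs_nonneg _).trans (hC 0)]
  simpa using h3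

end StepApprox

/-! ### Gaussian approximation of a product of characteristic functions -/

theorem norm_exp_mul_I_sub_taylor_le {y : ℝ} (hy : |y| ≤ 1) :
    ‖Complex.exp (y * Complex.I) - (1 + y * Complex.I - (y : ℂ) ^ 2 / 2)‖ ≤ 2 / 9 * |y| ^ 3 := by
  have hn : ‖(y * Complex.I : ℂ)‖ = |y| := by simp
  have h1 := Complex.exp_bound (x := y * Complex.I) (by rw [hn]; exact hy) (n := 3) (by norm_num)
  rw [hn] at h1
  simp only [Finset.sum_range_succ, Finset.sum_range_zero, Nat.factorial] at h1
  convert h1 using 1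
  · congr 2
    norm_num
    rw [mul_pow, Complex.I_sq]
    ring
  · norm_num
    ring

theorem integral_sq_le_of_abs_le {Ω : Type*} [MeasurableSpace Ω] {P : Measure Ω}
    [IsProbabilityMeasure P] {X : Ω → ℝ} (hX : Measurable X) {C : ℝ} (hC : ∀ ω, |X ω| ≤ C) :
    Integrable (fun ω => X ω ^ 2) P ∧ ∫ ω, X ω ^ 2 ∂P ≤ C ^ 2 := by
  have hX2i : Integrable (fun ω => X ω ^ 2) P :=
    Integrable.of_bound (hX.pow_const 2).aestronglyMeasurable (C ^ 2) (ae_of_all _ fun ω => by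
      rw [norm_pow]; exact pow_le_pow_left₀ (norm_nonneg _) (hC ω) 2)
  refine ⟨hX2i, ?_⟩
  have h1 := integral_mono hX2i (integrable_const (C ^ 2)) fun ω => by
    have := pow_le_pow_left₀ (abs_nonneg _) (hC ω) 2
    rwa [sq_abs] at this
  simpa using h1

/-- Both exponentials are compared with `1 - u² σ / 2`, the linear term vanishing by `hmean`. With
`z = |u| * C ≤ 1` the errors are `2 / 9 * z ^ 3` and `(u² σ / 2)² ≤ z ^ 4 / 4 ≤ z ^ 3 / 4`. -/
theorem norm_integral_exp_sub_exp_le {Ω : Type*} [MeasurableSpace Ω] {P : Measure Ω}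
    [IsProbabilityMeasure P] {X : Ω → ℝ} (hX : Measurable X) {C : ℝ} (hC : ∀ ω, |X ω| ≤ C)
    (hmean : ∫ ω, X ω ∂P = 0) {u : ℝ} (hu : |u| * C ≤ 1) :
    ‖expChar P X u - Complex.exp (-((u : ℂ) ^ 2 * (∫ ω, X ω ^ 2 ∂P : ℝ) / 2))‖ ≤
      (|u| * C) ^ 3 := by
  have hXi : Integrable X P := Integrable.of_bound hX.aestronglyMeasurable C (ae_of_all _ hC)
  obtain ⟨hX2i, hσC⟩ := integral_sq_le_of_abs_le (P := P) hX hC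
  set σ := ∫ ω, X ω ^ 2 ∂P
  have hσ0 : 0 ≤ σ := integral_nonneg fun ω => sq_nonneg _
  have hC0 : 0 ≤ |u| * C := by
    have hne : Nonempty Ω := P.nonempty_of_neZero
    exact mul_nonneg (abs_nonneg _) ((abs_nonneg _).trans (hC hne.some))
  set z := |u| * C
  have huX : ∀ ω, |u * X ω| ≤ z := fun ω => by
    rw [abs_mul]; exact mul_le_mul_of_nonneg_left (hC ω) (abs_nonneg _)
  have hT : ∫ ω, (1 + ((u * X ω : ℝ) : ℂ) * Complex.I - ((u * X ω : ℝ) : ℂ) ^ 2 / 2) ∂P =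
      ((1 - u ^ 2 * σ / 2 : ℝ) : ℂ) := by
    have e : ∀ ω, (1 + ((u * X ω : ℝ) : ℂ) * Complex.I - ((u * X ω : ℝ) : ℂ) ^ 2 / 2) =
        1 + ((X ω : ℝ) : ℂ) * (u * Complex.I) - ((X ω ^ 2 : ℝ) : ℂ) * ((u : ℂ) ^ 2 / 2) :=
      fun ω => by push_cast; ring
    have i1 : Integrable (fun ω => ((X ω : ℝ) : ℂ) * (u * Complex.I)) P := hXi.ofReal.mul_const _
    have i2 : Integrable (fun ω => ((X ω ^ 2 : ℝ) : ℂ) * ((u : ℂ) ^ 2 / 2)) P :=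
      hX2i.ofReal.mul_const _
    simp_rw [e]
    have i0 : Integrable (fun ω => 1 + ((X ω : ℝ) : ℂ) * (u * Complex.I)) P :=
      (integrable_const _).add i1
    rw [integral_sub i0 i2, integral_add (integrable_const _) i1,
      integral_mul_const, integral_mul_const, integral_complex_ofReal, integral_complex_ofReal, hmean]
    simp only [integral_const, probReal_univ, one_smul, Complex.ofReal_zero, zero_mul, add_zero]
    push_cast
    ring
  have hEi : Integrable (fun ω => Complex.exp (((u * X ω : ℝ) : ℂ) * Complex.I)) P :=
    Integrable.of_bound (Measurable.aestronglyMeasurable (by fun_prop)) 1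
      (ae_of_all _ fun ω => (Complex.norm_exp_ofReal_mul_I _).le)
  have hTi : Integrable
      (fun ω => 1 + ((u * X ω : ℝ) : ℂ) * Complex.I - ((u * X ω : ℝ) : ℂ) ^ 2 / 2) P := by
    have j1 : Integrable (fun ω => ((u * X ω : ℝ) : ℂ)) P := (hXi.const_mul u).ofReal
    have j2 : Integrable (fun ω => ((u * X ω : ℝ) : ℂ) ^ 2 / 2) P := by
      have : Integrable (fun ω => ((u ^ 2 * X ω ^ 2 : ℝ) : ℂ) / 2) P :=
        (hX2i.const_mul (u ^ 2)).ofReal.div_const 2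
      refine this.congr (ae_of_all _ fun ω => ?_)
      push_cast; ring
    exact ((integrable_const _).add (j1.mul_const _)).sub j2
  have h1 : ‖expChar P X u - ((1 - u ^ 2 * σ / 2 : ℝ) : ℂ)‖ ≤ 2 / 9 * z ^ 3 := by
    rw [← hT, expChar, ← integral_sub hEi hTi]
    have := norm_integral_le_of_norm_le_const (μ := P) (C := 2 / 9 * z ^ 3)
      (f := fun ω => Complex.exp (((u * X ω : ℝ) : ℂ) * Complex.I) -
        (1 + ((u * X ω : ℝ) : ℂ) * Complex.I - ((u * X ω : ℝ) : ℂ) ^ 2 / 2))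
      (ae_of_all _ fun ω => (norm_exp_mul_I_sub_taylor_le ((huX ω).trans hu)).trans
        (mul_le_mul_of_nonneg_left (pow_le_pow_left₀ (abs_nonneg _) (huX ω) 3) (by norm_num)))
    simpa using this
  have hz2 : u ^ 2 * σ ≤ z ^ 2 := by
    have : z ^ 2 = u ^ 2 * C ^ 2 := by simp only [z, mul_pow, sq_abs]
    rw [this]
    exact mul_le_mul_of_nonneg_left hσC (sq_nonneg _)
  have hy0 : 0 ≤ u ^ 2 * σ := mul_nonneg (sq_nonneg _) hσ0
  have hz1 : z ^ 2 ≤ 1 := pow_le_one₀ hC0 hu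
  have h2 : |Real.exp (-(u ^ 2 * σ / 2)) - 1 - -(u ^ 2 * σ / 2)| ≤ (-(u ^ 2 * σ / 2)) ^ 2 := by
    refine Real.abs_exp_sub_one_sub_id_le ?_
    rw [abs_neg, abs_of_nonneg (by linarith)]
    linarith
  have h3 : (-(u ^ 2 * σ / 2)) ^ 2 ≤ 1 / 4 * z ^ 3 := by
    have h4 : (u ^ 2 * σ) ^ 2 ≤ (z ^ 2) ^ 2 := pow_le_pow_left₀ hy0 hz2 2
    have h5 : (z ^ 2) ^ 2 ≤ z ^ 3 := by
      rw [← pow_mul]; exact pow_le_pow_of_le_one hC0 hu (by norm_num)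
    nlinarith
  have h6 : ‖((1 - u ^ 2 * σ / 2 : ℝ) : ℂ) - Complex.exp (-((u : ℂ) ^ 2 * (σ : ℝ) / 2))‖ ≤
      1 / 4 * z ^ 3 := by
    have e : ((1 - u ^ 2 * σ / 2 : ℝ) : ℂ) - Complex.exp (-((u : ℂ) ^ 2 * (σ : ℝ) / 2)) =
        ((-(Real.exp (-(u ^ 2 * σ / 2)) - 1 - -(u ^ 2 * σ / 2)) : ℝ) : ℂ) := by
      push_cast; ring
    rw [e, Complex.norm_real, Real.norm_eq_abs, abs_neg]
    exact h2.trans h3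
  have hz3 : 0 ≤ z ^ 3 := pow_nonneg hC0 3
  calc _ ≤ _ := norm_sub_le_norm_sub_add_norm_sub _ ((1 - u ^ 2 * σ / 2 : ℝ) : ℂ) _
    _ ≤ 2 / 9 * z ^ 3 + 1 / 4 * z ^ 3 := add_le_add h1 h6
    _ ≤ z ^ 3 := by linarith

/-- Errors are taken relative to the Gaussian factor: `c i = exp (-y i) * (1 + r i)` with `‖r i‖ ≤
exp (1 / 2) * ε i ≤ 2 * ε i`. A telescoping bound would lose the prefactor `exp (-∑ y i)`, whose
decay is needed when integrating in `s`. -/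
theorem norm_prod_sub_exp_neg_sum_le {ι : Type*} (s : Finset ι) {c : ι → ℂ} {y ε : ι → ℝ}
    (hy : ∀ i ∈ s, y i ≤ 1 / 2)
    (hc : ∀ i ∈ s, ‖c i - Complex.exp (-(y i : ℂ))‖ ≤ ε i) :
    ‖∏ i ∈ s, c i - Complex.exp (-((∑ i ∈ s, y i : ℝ) : ℂ))‖ ≤
      Real.exp (-∑ i ∈ s, y i) * (Real.exp (2 * ∑ i ∈ s, ε i) - 1) := by
  set r : ι → ℂ := fun i => Complex.exp (y i) * (c i - Complex.exp (-(y i : ℂ))) with hr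
  have hcr : ∀ i, c i = Complex.exp (-(y i : ℂ)) * (1 + r i) := fun i => by
    simp only [hr, mul_add, mul_one, ← mul_assoc, ← Complex.exp_add]
    simp
  have hprod : ∏ i ∈ s, c i =
      Complex.exp (-((∑ i ∈ s, y i : ℝ) : ℂ)) * ∏ i ∈ s, (1 + r i) := by
    rw [Finset.prod_congr rfl fun i _ => hcr i, Finset.prod_mul_distrib, ← Complex.exp_sum]
    push_cast
    rw [Finset.sum_neg_distrib]
  have he : Complex.exp (-((∑ i ∈ s, y i : ℝ) : ℂ)) = ((Real.exp (-∑ i ∈ s, y i) : ℝ) : ℂ) := by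
    push_cast; rfl
  have hrε : ∑ i ∈ s, ‖r i‖ ≤ 2 * ∑ i ∈ s, ε i := by
    rw [Finset.mul_sum]
    refine Finset.sum_le_sum fun i hi => ?_
    have h1 : ‖Complex.exp (y i : ℂ)‖ ≤ 2 := by
      rw [Complex.norm_exp, Complex.ofReal_re]
      refine (Real.exp_le_exp.2 (hy i hi)).trans
        ((Real.exp_bound_div_one_sub_of_interval (by norm_num) (by norm_num)).trans ?_)
      norm_num
    rw [hr, norm_mul]
    exact mul_le_mul h1 (hc i hi) (norm_nonneg _) (by norm_num)
  rw [hprod, ← mul_sub_one, norm_mul, he, Complex.norm_real, Real.norm_eq_abs, Real.abs_exp]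
  refine mul_le_mul_of_nonneg_left ?_ (Real.exp_pos _).le
  exact (s.norm_prod_one_add_sub_one_le r).trans
    (sub_le_sub_right (Real.exp_le_exp.2 hrε) 1)

/-! ### Asymptotics of the coefficient array -/

theorem eventually_forall_abs_le {a : ℕ → ℕ → ℝ}
    (h3 : Tendsto (fun n => ∑ k ∈ Finset.Icc 1 n, |a k n| ^ 3) atTop (𝓝 0)) {r : ℝ} (hr : 0 < r) :
    ∀ᶠ n in atTop, ∀ k ∈ Finset.Icc 1 n, |a k n| ≤ r := by
  filter_upwards [h3.eventually_le_const (pow_pos hr 3)] with n hn k hk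
  have h1 := Finset.single_le_sum (f := fun k => |a k n| ^ 3) (fun _ _ => by positivity) hk
  exact le_of_pow_le_pow_left₀ three_ne_zero hr.le (h1.trans hn)

theorem rowNorm_sq (a : ℕ → ℕ → ℝ) (n : ℕ) :
    rowNorm a n ^ 2 = ∑ k ∈ Finset.Icc 1 n, a k n ^ 2 :=
  Real.sq_sqrt (Finset.sum_nonneg fun _ _ => sq_nonneg _)

/-- A Toeplitz averaging argument: the indices `k < N`, where `σ k` may be far from `1`, contribute
at most the constant `D` since eventually `|a k n| ≤ 1`, and `rowNorm a n ^ 2 → ∞` makes this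
negligible. -/
theorem tendsto_weighted_variance {a : ℕ → ℕ → ℝ} {σ : ℕ → ℝ} (hσ : Tendsto σ atTop (𝓝 1))
    (hA : Tendsto (rowNorm a) atTop atTop)
    (h3 : Tendsto (fun n => ∑ k ∈ Finset.Icc 1 n, |a k n| ^ 3) atTop (𝓝 0)) :
    Tendsto (fun n => (∑ k ∈ Finset.Icc 1 n, a k n ^ 2 * σ k) / rowNorm a n ^ 2) atTop (𝓝 1) := by
  rw [Metric.tendsto_atTop']
  intro ε hε
  obtain ⟨N, hN⟩ := Metric.tendsto_atTop.1 hσ (ε / 2) (by linarith)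
  set D := ∑ k ∈ Finset.range N, |σ k - 1|
  have hA2 : Tendsto (fun n => D / rowNorm a n ^ 2) atTop (𝓝 0) :=
    tendsto_const_nhds.div_atTop ((tendsto_pow_atTop two_ne_zero).comp hA)
  have key : ∀ᶠ n in atTop,
      dist ((∑ k ∈ Finset.Icc 1 n, a k n ^ 2 * σ k) / rowNorm a n ^ 2) 1 < ε := by
    filter_upwards [eventually_forall_abs_le h3 one_pos, hA.eventually_gt_atTop 0,
      hA2.eventually_lt_const (show 0 < ε / 2 by linarith)] with n hn hpos hD
    have hp2 : 0 < rowNorm a n ^ 2 := by positivity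
    have h1 : |∑ k ∈ Finset.Icc 1 n, a k n ^ 2 * (σ k - 1)| ≤
        ε / 2 * rowNorm a n ^ 2 + D := by
      have h2 : ∀ k ∈ Finset.Icc 1 n, |a k n ^ 2 * (σ k - 1)| ≤
          ε / 2 * a k n ^ 2 + if k < N then |σ k - 1| else 0 := by
        intro k hk
        rw [abs_mul, abs_of_nonneg (sq_nonneg _)]
        split_ifs with hkN
        · have h4 : a k n ^ 2 ≤ 1 := (sq_le_one_iff_abs_le_one _).2 (hn k hk)
          have := mul_le_mul_of_nonneg_right h4 (abs_nonneg (σ k - 1))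
          nlinarith [sq_nonneg (a k n)]
        · have h5 := hN k (not_lt.1 hkN)
          rw [Real.dist_eq] at h5
          nlinarith [sq_nonneg (a k n)]
      refine (Finset.abs_sum_le_sum_abs _ _).trans ((Finset.sum_le_sum h2).trans ?_)
      rw [Finset.sum_add_distrib, ← Finset.mul_sum, ← rowNorm_sq, ← Finset.sum_filter]
      refine add_le_add_right (Finset.sum_le_sum_of_subset_of_nonneg (fun k hk => ?_)
        fun _ _ _ => abs_nonneg _) _
      exact Finset.mem_range.2 (Finset.mem_filter.1 hk).2
    have e : (∑ k ∈ Finset.Icc 1 n, a k n ^ 2 * σ k) / rowNorm a n ^ 2 - 1 =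
        (∑ k ∈ Finset.Icc 1 n, a k n ^ 2 * (σ k - 1)) / rowNorm a n ^ 2 := by
      simp_rw [mul_sub, mul_one]
      rw [Finset.sum_sub_distrib, ← rowNorm_sq, sub_div, div_self hp2.ne']
    rw [Real.dist_eq, e, abs_div, abs_of_pos hp2]
    calc _ ≤ (ε / 2 * rowNorm a n ^ 2 + D) / rowNorm a n ^ 2 := by gcongr
      _ = ε / 2 + D / rowNorm a n ^ 2 := by field_simp
      _ < ε := by linarith
  obtain ⟨n₀, hn₀⟩ := eventually_atTop.1 key
  exact ⟨n₀, fun n hn => hn₀ n hn.le⟩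

theorem exists_abs_le_of_holder_periodic {f : ℝ → ℝ} (hf : Function.Periodic f 1) {h α : ℝ}
    (hα : 0 < α)
    (hol : ∀ x ∈ Ico (0 : ℝ) 1, ∀ y ∈ Ico (0 : ℝ) 1, |f x - f y| ≤ h * |x - y| ^ α) :
    0 ≤ h ∧ ∃ C, ∀ x, |f x| ≤ C := by
  have hh : 0 ≤ h := by
    have h1 := hol 0 (by norm_num) (1 / 2) (by norm_num)
    have h2 : (0 : ℝ) < |0 - 1 / 2| ^ α := Real.rpow_pos_of_pos (by norm_num) _
    exact nonneg_of_mul_nonneg_left ((abs_nonneg _).trans h1) h2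
  refine ⟨hh, |f 0| + h, fun x => ?_⟩
  have hx : f x = f (Int.fract x) := by
    have := hf.int_mul ⌊x⌋ (Int.fract x)
    rwa [mul_one, Int.fract_add_floor] at this
  have h1 := hol (Int.fract x) ⟨Int.fract_nonneg x, Int.fract_lt_one x⟩ 0 (by norm_num)
  have h2 : |Int.fract x - 0| ^ α ≤ 1 := by
    rw [sub_zero, abs_of_nonneg (Int.fract_nonneg x)]
    exact Real.rpow_le_one (Int.fract_nonneg x) (Int.fract_lt_one x).le hα.le
  have h3 := mul_le_mul_of_nonneg_left h2 hh
  rw [hx]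
  have h4 := abs_sub_abs_le_abs_sub (f (Int.fract x)) (f 0)
  linarith

/-! ### Characteristic functions of the gap sums -/

theorem norm_expChar_sub_le {Ω : Type*} [MeasurableSpace Ω] {P : Measure Ω}
    [IsProbabilityMeasure P] {S T : Ω → ℝ} (hS : Measurable S) (hT : Measurable T) {δ : ℝ}
    (hST : ∀ ω, |S ω - T ω| ≤ δ) (s : ℝ) : ‖expChar P S s - expChar P T s‖ ≤ |s| * δ := by
  have hi : ∀ {Y : Ω → ℝ}, Measurable Y →
      Integrable (fun ω => Complex.exp (((s * Y ω : ℝ) : ℂ) * Complex.I)) P := fun {Y} hY =>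
    Integrable.of_bound (Measurable.aestronglyMeasurable (by fun_prop)) 1
      (ae_of_all _ fun ω => (Complex.norm_exp_ofReal_mul_I _).le)
  rw [expChar, expChar, ← integral_sub (hi hS) (hi hT)]
  have := norm_integral_le_of_norm_le_const (μ := P) (C := |s| * δ)
    (f := fun ω => Complex.exp (((s * S ω : ℝ) : ℂ) * Complex.I) -
      Complex.exp (((s * T ω : ℝ) : ℂ) * Complex.I)) (ae_of_all _ fun ω => by
      have e : Complex.exp (((s * S ω : ℝ) : ℂ) * Complex.I) -
          Complex.exp (((s * T ω : ℝ) : ℂ) * Complex.I) =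
          Complex.exp (((s * T ω : ℝ) : ℂ) * Complex.I) *
            (Complex.exp (Complex.I * ((s * (S ω - T ω) : ℝ) : ℂ)) - 1) := by
        rw [mul_sub, mul_one, ← Complex.exp_add]
        push_cast
        ring_nf
      rw [e, norm_mul, Complex.norm_exp_ofReal_mul_I, one_mul]
      refine (Real.norm_exp_I_mul_ofReal_sub_one_le).trans ?_
      rw [norm_mul, Real.norm_eq_abs, Real.norm_eq_abs]
      exact mul_le_mul_of_nonneg_left (hST ω) (abs_nonneg _))
  simpa using this

theorem integral_restrict_Icc_eq {E : Type*} [NormedAddCommGroup E] [NormedSpace ℝ E]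
    (g : ℝ → E) : ∫ x, g x ∂(volume.restrict (Icc (0 : ℝ) 1)) = ∫ x in (0 : ℝ)..1, g x := by
  rw [intervalIntegral.integral_of_le zero_le_one, integral_Icc_eq_integral_Ioc]

/-- The characteristic function of the approximating sum of independent step functions. -/
theorem expChar_sum_stepApprox {f : ℝ → ℝ} (hf : Measurable f) (hper : Function.Periodic f 1)
    {M b : ℕ → ℕ} (hM : ∀ k, 1 ≤ k → 0 < M k) (hb : ∀ k, 1 ≤ k → 0 < b k)
    (hMb : ∀ k, 1 ≤ k → M (k + 1) = b k * M k) (c : ℕ → ℝ) (n : ℕ) (s : ℝ) :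
    expChar (volume.restrict (Icc (0 : ℝ) 1))
      (fun x => ∑ k ∈ Finset.Icc 1 n, c k * stepApprox f (b k) (M k * x)) s =
    ∏ k ∈ Finset.Icc 1 n,
      expChar (volume.restrict (Icc (0 : ℝ) 1)) (stepApprox f (b k)) (s * c k) := by
  simp only [expChar, integral_restrict_Icc_eq]
  rw [← integral_prod_step_periodic hM hb hMb
    (g := fun k x => Complex.exp (((s * c k * stepApprox f (b k) x : ℝ) : ℂ) * Complex.I))]
  · congr 1 with x
    rw [← Complex.exp_sum, ← Finset.sum_mul, Finset.mul_sum]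
    push_cast
    simp only [mul_assoc]
  · intro k hk x
    simp only [periodic_stepApprox hper (hb k hk) x]
  · intro k hk y
    simp only [← stepApprox_floor (hb k hk) y]
  · intro k hk x y
    have := measurable_stepApprox hf (b k)
    exact (intervalIntegrable_const (c := (1 : ℝ))).mono_fun'
      (Measurable.aestronglyMeasurable (by fun_prop))
      (ae_of_all _ fun x => (Complex.norm_exp_ofReal_mul_I _).le)

/-- The last summand of the bound pays for replacing `f` by step functions; the first is the product
estimate for the resulting independent terms, each bounded by `2 * C`. `hsmall` puts every factor in
the range of the Taylor bound. -/
theorem norm_expChar_gapSum_sub_le {f : ℝ → ℝ} (hfm : Measurable f)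
    (hper : Function.Periodic f 1) {h α C : ℝ} (hC : ∀ x, |f x| ≤ C) (hh : 0 ≤ h) (hα : 0 < α)
    (hol : ∀ x ∈ Ico (0 : ℝ) 1, ∀ y ∈ Ico (0 : ℝ) 1, |f x - f y| ≤ h * |x - y| ^ α)
    (hmean : ∫ x in (0 : ℝ)..1, f x = 0) {m : ℕ → ℤ} {b : ℕ → ℕ} (hm : ∀ k, 1 ≤ k → 0 < m k)
    (hb : ∀ k, 1 ≤ k → 0 < b k) (hmb : ∀ k, 1 ≤ k → m (k + 1) = (b k : ℤ) * m k)
    (a : ℕ → ℕ → ℝ) (n : ℕ) {s K : ℝ} (hs : |s| ≤ K)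
    (hsmall : ∀ k ∈ Finset.Icc 1 n, K * |a k n| * (2 * C) ≤ 1) :
    ‖expChar (volume.restrict (Icc (0 : ℝ) 1)) (gapSum f m a n) s - Complex.exp (-((∑ k ∈
        Finset.Icc 1 n, (s * a k n) ^ 2 * (∫ x in (0 : ℝ)..1, stepApprox f (b k) x ^ 2) / 2 : ℝ) :
          ℂ))‖ ≤
      Real.exp (-∑ k ∈ Finset.Icc 1 n,
        (s * a k n) ^ 2 * (∫ x in (0 : ℝ)..1, stepApprox f (b k) x ^ 2) / 2) *
        (Real.exp (2 * ((K * (2 * C)) ^ 3 * ∑ k ∈ Finset.Icc 1 n, |a k n| ^ 3)) - 1) +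
      K * (2 * h * ∑ k ∈ Finset.Icc 1 n, |a k n| / (b k : ℝ) ^ α) := by
  have hP : IsProbabilityMeasure (volume.restrict (Icc (0 : ℝ) 1)) := ⟨by simp⟩
  have hC0 : 0 ≤ C := (abs_nonneg _).trans (hC 0)
  have hK : 0 ≤ K := (abs_nonneg _).trans hs
  set P := volume.restrict (Icc (0 : ℝ) 1)
  set M : ℕ → ℕ := fun k => (m k).toNat
  have hMm : ∀ k, 1 ≤ k → ((M k : ℕ) : ℤ) = m k := fun k hk => Int.toNat_of_nonneg (hm k hk).le
  have hMr : ∀ k, 1 ≤ k → ((M k : ℕ) : ℝ) = (m k : ℝ) := fun k hk => by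
    rw [← hMm k hk, Int.cast_natCast]
  have hM0 : ∀ k, 1 ≤ k → 0 < M k := fun k hk => by
    have := hMm k hk; have := hm k hk; omega
  have hMb : ∀ k, 1 ≤ k → M (k + 1) = b k * M k := fun k hk => by
    have := hmb k hk
    rw [← hMm k hk, ← hMm (k + 1) (by omega)] at this
    exact_mod_cast this
  set T : ℝ → ℝ := fun x => ∑ k ∈ Finset.Icc 1 n, a k n * stepApprox f (b k) (M k * x) with hT
  have hXm := fun k => measurable_stepApprox hfm (b k)
  have hTm : Measurable T := Finset.measurable_sum _ fun k _ =>
    ((hXm k).comp (by fun_prop)).const_mul _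
  have hSm : Measurable (gapSum f m a n) := Finset.measurable_sum _ fun k _ =>
    (hfm.comp (by fun_prop)).const_mul _
  have hST : ∀ x, |gapSum f m a n x - T x| ≤
      2 * h * ∑ k ∈ Finset.Icc 1 n, |a k n| / (b k : ℝ) ^ α := by
    intro x
    rw [gapSum, hT, ← Finset.sum_sub_distrib, Finset.mul_sum]
    refine (Finset.abs_sum_le_sum_abs _ _).trans (Finset.sum_le_sum fun k hk => ?_)
    have hk1 := (Finset.mem_Icc.1 hk).1
    rw [hMr k hk1, ← mul_sub, abs_mul]
    refine (mul_le_mul_of_nonneg_left (abs_sub_stepApprox_le hfm hC hper hh hα hol hmean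
      (hb k hk1) _) (abs_nonneg _)).trans_eq ?_
    ring
  have h1 := norm_expChar_sub_le (P := P) hSm hTm hST s
  have hδ0 : 0 ≤ 2 * h * ∑ k ∈ Finset.Icc 1 n, |a k n| / (b k : ℝ) ^ α :=
    (abs_nonneg _).trans (hST 0)
  have hsa : ∀ k ∈ Finset.Icc 1 n, |s * a k n| * (2 * C) ≤ K * |a k n| * (2 * C) := fun k _ => by
    rw [abs_mul]; gcongr
  have h2 := norm_prod_sub_exp_neg_sum_le (Finset.Icc 1 n)
    (c := fun k => expChar P (stepApprox f (b k)) (s * a k n))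
    (y := fun k => (s * a k n) ^ 2 * (∫ x in (0 : ℝ)..1, stepApprox f (b k) x ^ 2) / 2)
    (ε := fun k => (K * |a k n| * (2 * C)) ^ 3) (fun k hk => ?_) (fun k hk => ?_)
  · have e : ∑ k ∈ Finset.Icc 1 n, (K * |a k n| * (2 * C)) ^ 3 =
        (K * (2 * C)) ^ 3 * ∑ k ∈ Finset.Icc 1 n, |a k n| ^ 3 := by
      rw [Finset.mul_sum]
      exact Finset.sum_congr rfl fun k _ => by ring
    rw [e, ← expChar_sum_stepApprox hfm hper hM0 hb hMb (fun k => a k n) n s] at h2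
    refine (norm_sub_le_norm_sub_add_norm_sub _ (expChar P T s) _).trans ?_
    rw [add_comm]
    exact add_le_add h2 (h1.trans (mul_le_mul_of_nonneg_right hs hδ0))
  · have h3 := (integral_sq_le_of_abs_le (P := P) (hXm k) (abs_stepApprox_le hC)).2
    rw [integral_restrict_Icc_eq] at h3
    have h4 : (|s * a k n| * (2 * C)) ^ 2 ≤ 1 :=
      pow_le_one₀ (by positivity) ((hsa k hk).trans (hsmall k hk))
    rw [mul_pow, sq_abs] at h4
    have := mul_le_mul_of_nonneg_left h3 (sq_nonneg (s * a k n))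
    linarith
  · have h5 := norm_integral_exp_sub_exp_le (P := P) (hXm k) (abs_stepApprox_le hC)
      (by rw [integral_restrict_Icc_eq]; exact integral_stepApprox hfm hC)
      ((hsa k hk).trans (hsmall k hk))
    rw [integral_restrict_Icc_eq] at h5
    refine le_trans (le_of_eq ?_) (h5.trans (pow_le_pow_left₀ (by positivity) (hsa k hk) 3))
    push_cast
    rfl

end ModGaussian

/-! ### The theorem -/

theorem mainTheorem9
    (f : ℝ → ℝ) (hf_meas : Measurable f) (hf_per : ∀ x, f (x + 1) = f x)
    (h α : ℝ) (hα : 0 < α)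
    (hf_holder : ∀ x ∈ Set.Ico (0 : ℝ) 1, ∀ y ∈ Set.Ico (0 : ℝ) 1, |f x - f y| ≤ h * |x - y| ^ α)
    (hf_mean : ∫ x in (0 : ℝ)..1, f x = 0)
    (hf_var : ∫ x in (0 : ℝ)..1, f x ^ 2 = 1)
    (m : ℕ → ℤ) (b : ℕ → ℕ)
    (hm_mono : StrictMonoOn m (Set.Ici 1))
    (hb_two : ∀ k, 1 ≤ k → 2 ≤ b k)
    (hmb : ∀ k, 1 ≤ k → m (k + 1) = (b k : ℤ) * m k)
    (hb_top : Tendsto b atTop atTop)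
    (a : ℕ → ℕ → ℝ)
    (hA : Tendsto (rowNorm a) atTop atTop)
    (ha_three : Tendsto (fun n => ∑ k ∈ Finset.Icc 1 n, |a k n| ^ 3) atTop (𝓝 0))
    (ha_gap : Tendsto
      (fun n => rowNorm a n * ∑ k ∈ Finset.Icc 1 n, |a k n| / (b k : ℝ) ^ α) atTop (𝓝 0)) :
    ConvergesModGaussianWeak (volume.restrict (Set.Icc (0 : ℝ) 1)) (gapSum f m a) (rowNorm a) ∧
    ∀ B : Set ℝ, IsBoundedJordanMeasurable B →
      Tendsto
        (fun n => rowNorm a n *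
          (volume {x : ℝ | x ∈ Set.Icc (0 : ℝ) 1 ∧ gapSum f m a n x ∈ B}).toReal)
        atTop (𝓝 ((volume B).toReal / √(2 * Real.pi))) := by
  have hper : Function.Periodic f 1 := hf_per
  obtain ⟨hh, C, hC⟩ := ModGaussian.exists_abs_le_of_holder_periodic hper hα hf_holder
  have hP : IsProbabilityMeasure (volume.restrict (Icc (0 : ℝ) 1)) := ⟨by simp⟩
  have hb : ∀ k, 1 ≤ k → 0 < b k := fun k hk => by have := hb_two k hk; omega
  -- Multiplying by `b k ≥ 2` increases `m k` only if `m k` is positive.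
  have hm : ∀ k, 1 ≤ k → 0 < m k := by
    intro k hk
    have h1 : m k < m (k + 1) := hm_mono hk (by simp) (Nat.lt_succ_self k)
    rw [hmb k hk] at h1
    have h2 : (2 : ℤ) ≤ b k := by exact_mod_cast hb_two k hk
    nlinarith
  have hA0 : ∀ n, 0 ≤ rowNorm a n := fun n => Real.sqrt_nonneg _
  have hS : ∀ n, Measurable (gapSum f m a n) := fun n => Finset.measurable_sum _ fun k _ =>
    (hf_meas.comp (by fun_prop)).const_mul _
  set σ : ℕ → ℝ := fun k => ∫ x in (0 : ℝ)..1, ModGaussian.stepApprox f (b k) x ^ 2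
  have hσ : Tendsto σ atTop (𝓝 1) := by
    have hbr : Tendsto (fun k => (b k : ℝ) ^ α) atTop atTop :=
      (tendsto_rpow_atTop hα).comp (tendsto_natCast_atTop_atTop.comp hb_top)
    have h0 : Tendsto (fun k => 3 * C * (2 * h / (b k : ℝ) ^ α)) atTop (𝓝 0) := by
      simpa using (tendsto_const_nhds.div_atTop hbr).const_mul (3 * C)
    rw [tendsto_iff_norm_sub_tendsto_zero]
    refine squeeze_zero' (Eventually.of_forall fun _ => norm_nonneg _) ?_ h0
    filter_upwards [eventually_ge_atTop 1] with k hk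
    exact ModGaussian.abs_integral_stepApprox_sq_sub_one_le hf_meas hC hper hh hα hf_holder
      hf_mean hf_var (hb k hk)
  have hC0 : 0 ≤ C := (abs_nonneg _).trans (hC 0)
  set v : ℕ → ℝ := fun n => (∑ k ∈ Finset.Icc 1 n, a k n ^ 2 * σ k) / rowNorm a n ^ 2 with hv_def
  have hbound : ∀ K : ℝ, 0 ≤ K → ∃ η δ : ℕ → ℝ, Tendsto η atTop (𝓝 0) ∧
      Tendsto (fun n => rowNorm a n * δ n) atTop (𝓝 0) ∧ ∀ᶠ n in atTop, ∀ s, |s| ≤ K →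
      ‖expChar (volume.restrict (Icc (0 : ℝ) 1)) (gapSum f m a n) s -
          Complex.exp (-((rowNorm a n : ℂ) ^ 2 * s ^ 2 * v n / 2))‖ ≤
        Real.exp (-(rowNorm a n ^ 2 * s ^ 2 * v n / 2)) * η n + δ n := by
    intro K hK
    refine ⟨fun n => Real.exp (2 * ((K * (2 * C)) ^ 3 * ∑ k ∈ Finset.Icc 1 n, |a k n| ^ 3)) - 1,
        fun n => K * (2 * h * ∑ k ∈ Finset.Icc 1 n, |a k n| / (b k : ℝ) ^ α), ?_, ?_, ?_⟩
    · have h1 := ((ha_three.const_mul ((K * (2 * C)) ^ 3)).const_mul 2).rexp.sub_const 1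
      simpa using h1
    · have h1 := ha_gap.const_mul (K * (2 * h))
      rw [mul_zero] at h1
      refine h1.congr fun n => ?_
      ring
    -- Coefficients below this threshold satisfy `K * |a k n| * (2 * C) ≤ 1`; the added `1` covers
    -- `K * C = 0`.
    · have hr : 0 < (K * (2 * C) + 1)⁻¹ := by positivity
      filter_upwards [ModGaussian.eventually_forall_abs_le ha_three hr,
        hA.eventually_gt_atTop 0] with n hn hpos s hs
      have hsum : ∑ k ∈ Finset.Icc 1 n, (s * a k n) ^ 2 * σ k / 2 = rowNorm a n ^ 2 * s ^ 2 *
          ((∑ k ∈ Finset.Icc 1 n, a k n ^ 2 * σ k) / rowNorm a n ^ 2) / 2 := by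
        have e : rowNorm a n ^ 2 * s ^ 2 *
            ((∑ k ∈ Finset.Icc 1 n, a k n ^ 2 * σ k) / rowNorm a n ^ 2) / 2 =
            s ^ 2 / 2 * ∑ k ∈ Finset.Icc 1 n, a k n ^ 2 * σ k := by
          field_simp
        rw [e, Finset.mul_sum]
        exact Finset.sum_congr rfl fun k _ => by ring
      have key := ModGaussian.norm_expChar_gapSum_sub_le hf_meas hper hC hh hα hf_holder hf_mean hm
        hb hmb a n hs fun k hk => by
          have h1 := mul_le_mul_of_nonneg_left (hn k hk) (show 0 ≤ K * (2 * C) by positivity)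
          have h2 : K * (2 * C) * (K * (2 * C) + 1)⁻¹ ≤ 1 := by
            rw [← div_eq_mul_inv, div_le_one (by positivity)]
            linarith
          nlinarith
      change ‖_ - Complex.exp (-((∑ k ∈ Finset.Icc 1 n, (s * a k n) ^ 2 * σ k / 2 : ℝ) : ℂ))‖ ≤
        Real.exp (-∑ k ∈ Finset.Icc 1 n, (s * a k n) ^ 2 * σ k / 2) * _ + _ at key
      rw [hsum] at key
      convert key using 4
      simp only [hv_def]
      push_cast
      rfl
  obtain ⟨hmod, hloc⟩ := ModGaussian.convergesModGaussianWeak_and_local_limit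
    (P := volume.restrict (Icc (0 : ℝ) 1)) (fun n => (hS n).aemeasurable) hA0 hA
    (ModGaussian.tendsto_weighted_variance hσ hA ha_three) hbound
  refine ⟨hmod, fun B hB => (hloc B hB).congr fun n => ?_⟩
  rw [measureReal_def, Measure.restrict_apply' measurableSet_Icc, inter_comm]
  rfl
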